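/- There is a universal constant $C>0$ such that the following holds. Let $n$ be a natural number, let $\epsilon$ be a real number, let $\mathcal H_A,\mathcal H_B$ be finite-dimensional complex Hilbert spaces, and let $|\psi\rangle\in\mathcal H_A\otimes\mathcal H_B$ with $\||\psi\rangle\|=1$. For $D\in\{A,B\}$ and $j\in[n]=\{1,\dots,n\}$ let $(X_j)_D,(Z_j)_D$ be reflections on $\mathcal H_D$ (Hermitian operators that square to the identity; an operator with subscript $A$ or $B$ acts as the identity on the other factor) such that, for $D\in\{A,B\}$, all $i\neq j$ in $[n]$ and all $P,Q\in\{X,Z\}$, $$(X_j)_D(Z_j)_D+(Z_j)_D(X_j)_D=0\quad\text{for all } j\in[n],$$ $$\big\|[P_i,Q_j]_D|\psi\rangle\big\|\le\epsilon ,$$ $$\big\|(P_j)_A\otimes(P_j)_B|\psi\rangle-|\psi\rangle\big\|\le\epsilon\quad\text{for all } j\in[n].$$ Write $|\mathrm{EPR}\rangle=\frac1{\sqrt2}(|00\rangle+|11\rangle)$, let $\sigma^x_j,\sigma^z_j$ be the Pauli matrices $\sigma^x=\begin{pmatrix}0&1\\1&0\end{pmatrix}$, $\sigma^z=\begin{pmatrix}1&0\\0&-1\end{pmatrix}$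 acting on the $j$-th qubit of $(\mathbb C^2)^{\otimes n}$, and let $$|\psi'\rangle=|\psi\rangle\otimes|\mathrm{EPR}\rangle^{\otimes n}_{A'}\otimes|\mathrm{EPR}\rangle^{\otimes n}_{B'}\in\mathcal H_A\otimes(\mathbb C^2)^{\otimes 2n}_{A'}\otimes\mathcal H_B\otimes(\mathbb C^2)^{\otimes 2n}_{B'} ,$$ where each of the $n$ pairs in $A'$ lies entirely within $A'$, and likewise for $B'$. Then there are finite-dimensional Hilbert spaces $\hat{\mathcal H}_A,\hat{\mathcal H}_B$, unitaries $U_D:\mathcal H_D\otimes(\mathbb C^2)^{\otimes 2n}_{D'}\to(\mathbb C^2)^{\otimes n}_D\otimes\hat{\mathcal H}_D$ for $D\in\{A,B\}$, and a unit vector $|\mathrm{extra}\rangle\in\hat{\mathcal H}_A\otimes\hat{\mathcal H}_B$ such that, with $|\mathrm{EPR}\rangle_{AB}^{\otimes n}$ the $n$ EPR pairs between the $j$-th qubits of $(\mathbb C^2)^{\otimes n}_A$ and $(\mathbb C^2)^{\otimes n}_B$, $$\big\|U_A\otimes U_B|\psi'\rangle-|\mathrm{EPR}\rangle_{AB}^{\otimes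 n}\otimes|\mathrm{extra}\rangle\big\|\le C\,n^{3/2}\epsilon ,$$ and for every $D\in\{A,B\}$ and $j\in[n]$, $$\big\|\big(U(X_j\otimes 1_{D'})U^\dagger-\sigma^x_j\otimes 1_{\hat{\mathcal H}}\big)_D\,|\mathrm{EPR}\rangle_{AB}^{\otimes n}\otimes|\mathrm{extra}\rangle\big\|\le C\,n^{3/2}\epsilon ,$$ $$\big\|\big(U(Z_j\otimes 1_{D'})U^\dagger-\sigma^z_j\otimes 1_{\hat{\mathcal H}}\big)_D\,|\mathrm{EPR}\rangle_{AB}^{\otimes n}\otimes|\mathrm{extra}\rangle\big\|\le C\,n^{3/2}\epsilon .$$ -/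

import Mathlib

open scoped TensorProduct

namespace EPRTest

noncomputable section

/-- The register `(ℂ²)^{⊗ι}` of qubits labelled by `ι`, in the computational basis
`|x⟩`, `x : ι → {0,1}`, with its Euclidean (Hilbert space) structure. -/
abbrev Qubits (ι : Type) [Fintype ι] : Type := EuclideanSpace ℂ (ι → Fin 2)

/-- The computational basis vector `|x⟩`. -/
def ket {ι : Type} [Fintype ι] [DecidableEq ι] (x : ι → Fin 2) : Qubits ι :=
  EuclideanSpace.single x (1 : ℂ)

/-- The amplitudes of `|EPR⟩ = (|00⟩ + |11⟩) / √2`. -/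
def eprAmp (a b : Fin 2) : ℂ := if a = b then ((Real.sqrt 2 : ℝ) : ℂ)⁻¹ else 0

/-- `|EPR⟩^{⊗n}` inside one register of `2n` qubits, the `j`-th pair consisting of the qubits
`(j, 0)` and `(j, 1)`. -/
def eprLocal (n : ℕ) : Qubits (Fin n × Fin 2) :=
  WithLp.toLp 2 fun x => ∏ j : Fin n, eprAmp (x (j, 0)) (x (j, 1))

/-- `|EPR⟩^{⊗n}` shared between two registers of `n` qubits each, the `j`-th pair consisting of
the `j`-th qubit of the first register and the `j`-th qubit of the second register. -/
def eprShared (n : ℕ) : Qubits (Fin n) ⊗[ℂ] Qubits (Fin n) :=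
  ∑ x : Fin n → Fin 2, ∑ y : Fin n → Fin 2,
    (∏ j : Fin n, eprAmp (x j) (y j)) • (ket x ⊗ₜ[ℂ] ket y)

/-- The one-qubit operator with matrix `M`, acting on the `j`-th qubit of a register and as the
identity on the other qubits. -/
def onQubit {ι : Type} [Fintype ι] [DecidableEq ι] (M : Matrix (Fin 2) (Fin 2) ℂ) (j : ι) :
    Module.End ℂ (Qubits ι) where
  toFun v := WithLp.toLp 2 fun x => ∑ b : Fin 2, M (x j) b * v (Function.update x j b)
  map_add' v w := by
    ext x
    simp [mul_add, Finset.sum_add_distrib]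
  map_smul' c v := by
    ext x
    simp [mul_add, mul_left_comm]

/-- The two letters `X` and `Z`. -/
inductive Letter : Type
  | X : Letter
  | Z : Letter

/-- The Pauli matrices `σ^x` and `σ^z`. -/
def pauli : Letter → Matrix (Fin 2) (Fin 2) ℂ
  | Letter.X => !![0, 1; 1, 0]
  | Letter.Z => !![1, 0; 0, -1]

section Operators

variable {E F : Type*} [NormedAddCommGroup E] [InnerProductSpace ℂ E]
  [NormedAddCommGroup F] [InnerProductSpace ℂ F]

/-- A reflection: a Hermitian operator that squares to the identity. -/
def IsReflection (R : Module.End ℂ E) : Prop := R.IsSymmetric ∧ R * R = 1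

/-- `T` acting on the first tensor factor: `T ⊗ 1`. -/
abbrev onFst (F : Type*) [NormedAddCommGroup F] [InnerProductSpace ℂ F] (T : Module.End ℂ E) :
    Module.End ℂ (E ⊗[ℂ] F) := TensorProduct.map T LinearMap.id

/-- `T` acting on the second tensor factor: `1 ⊗ T`. -/
abbrev onSnd (E : Type*) [NormedAddCommGroup E] [InnerProductSpace ℂ E] (T : Module.End ℂ F) :
    Module.End ℂ (E ⊗[ℂ] F) := TensorProduct.map LinearMap.id T

end Operators

section States

variable {HA HB : Type*} [NormedAddCommGroup HA] [InnerProductSpace ℂ HA]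
  [NormedAddCommGroup HB] [InnerProductSpace ℂ HB]

/-- The assumptions on a state `ψ` in `H_A ⊗ H_B` and operators `(X_j)_D, (Z_j)_D` for
`D ∈ {A, B}` (given as `PA`, `PB`, indexed by the letter and by `j`): the state is a unit vector,
all operators are reflections, `X_j` and `Z_j` anti-commute exactly, operators of different
indices commute on `ψ` up to `ε`, and `ψ` is stabilized up to `ε` by each `P_j ⊗ P_j`. -/
structure OverlappingQubits (n : ℕ) (ε : ℝ) (ψ : HA ⊗[ℂ] HB)
    (PA : Letter → Fin n → Module.End ℂ HA) (PB : Letter → Fin n → Module.End ℂ HB) : Prop where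
  norm_state : ‖ψ‖ = 1
  reflection_A : ∀ P j, IsReflection (PA P j)
  reflection_B : ∀ P j, IsReflection (PB P j)
  anticomm_A : ∀ j, PA Letter.X j * PA Letter.Z j + PA Letter.Z j * PA Letter.X j = 0
  anticomm_B : ∀ j, PB Letter.X j * PB Letter.Z j + PB Letter.Z j * PB Letter.X j = 0
  comm_A : ∀ P Q i j, i ≠ j → ‖onFst HB (PA P i * PA Q j - PA Q j * PA P i) ψ‖ ≤ ε
  comm_B : ∀ P Q i j, i ≠ j → ‖onSnd HA (PB P i * PB Q j - PB Q j * PB P i) ψ‖ ≤ ε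
  stabilized : ∀ P j, ‖TensorProduct.map (PA P j) (PB P j) ψ - ψ‖ ≤ ε

/-- `|ψ'⟩ = |ψ⟩ ⊗ |EPR⟩^{⊗n}_{A'} ⊗ |EPR⟩^{⊗n}_{B'}`, with the factors ordered as
`(H_A ⊗ A') ⊗ (H_B ⊗ B')`. -/
def extendedState (n : ℕ) (ψ : HA ⊗[ℂ] HB) :
    (HA ⊗[ℂ] Qubits (Fin n × Fin 2)) ⊗[ℂ] (HB ⊗[ℂ] Qubits (Fin n × Fin 2)) :=
  TensorProduct.tensorTensorTensorComm ℂ HA HB (Qubits (Fin n × Fin 2)) (Qubits (Fin n × Fin 2))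
    (ψ ⊗ₜ[ℂ] (eprLocal n ⊗ₜ[ℂ] eprLocal n))

/-- `|EPR⟩_{AB}^{⊗n} ⊗ |extra⟩`, with the factors ordered as
`((ℂ²)^{⊗n}_A ⊗ K_A) ⊗ ((ℂ²)^{⊗n}_B ⊗ K_B)`. -/
def idealState (n : ℕ) {KA KB : Type*} [NormedAddCommGroup KA] [InnerProductSpace ℂ KA]
    [NormedAddCommGroup KB] [InnerProductSpace ℂ KB] (extra : KA ⊗[ℂ] KB) :
    (Qubits (Fin n) ⊗[ℂ] KA) ⊗[ℂ] (Qubits (Fin n) ⊗[ℂ] KB) :=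
  TensorProduct.tensorTensorTensorComm ℂ (Qubits (Fin n)) (Qubits (Fin n)) KA KB
    (eprShared n ⊗ₜ[ℂ] extra)

/-- The defect operator `U (P ⊗ 1_{D'}) U† - σ_j ⊗ 1_K` on `(ℂ²)^{⊗n} ⊗ K`, for an operator `P` on
`H`, a unitary `U` from `H ⊗ (ℂ²)^{⊗2n}` to `(ℂ²)^{⊗n} ⊗ K` and a one-qubit matrix `σ`. -/
def pauliDefect {n : ℕ} {H K : Type*} [NormedAddCommGroup H] [InnerProductSpace ℂ H]
    [NormedAddCommGroup K] [InnerProductSpace ℂ K]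
    (U : (H ⊗[ℂ] Qubits (Fin n × Fin 2)) ≃ₗᵢ[ℂ] (Qubits (Fin n) ⊗[ℂ] K))
    (P : Module.End ℂ H) (σ : Matrix (Fin 2) (Fin 2) ℂ) (j : Fin n) :
    Module.End ℂ (Qubits (Fin n) ⊗[ℂ] K) :=
  U.toLinearEquiv.toLinearMap ∘ₗ onFst (Qubits (Fin n × Fin 2)) P
      ∘ₗ U.symm.toLinearEquiv.toLinearMap
    - onFst K (onQubit σ j)

end States

end

end EPRTest

/-! The given qubits commute only approximately, and only on the state. They are replaced by exactly
commuting qubits that act on the state almost as the given ones do, and an exact stabilizer argument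
is applied to the replacements.

Each side carries ancillary pairs `(j, 0)`, `(j, 1)` in EPR states. The gate `S_k = swapGate p q k`
swaps the qubit `(X_k, Z_k)` with the ancilla `(k, 0)`. Conjugating the Paulis of the ancilla `(j,
0)` by the product of all gates gives qubits, called `extracted`, which inherit the exact
commutation of the ancillas. Gates later than `j` cancel in this conjugation and gate `j` turns the
ancilla into `p P j`, so what remains is `p P j` conjugated by gates of smaller index
(`swapOut_conj`).

These remaining gates almost commute with `p P j` on the state. A naive telescoping fails, because
approximate commutation is known only on the state itself and not after other gates have acted. On
the state, however, `S_k` acts up to `O(ε)` as a gate built from the other party's qubit `k` and the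
EPR partner `(k, 1)`, and that gate commutes exactly with everything in play. Gates can thus be
parked on the other side while `p P j` moves past, at cost `9ε` per gate
(`norm_commutator_reverse_prod_le`, `norm_swapOut_conj_sub_le`).

Hence the extracted qubits of both sides satisfy the stabilizer relations up to `19nε`. After the
unitaries these are the `2n` commuting reflections `σ_j ⊗ σ_j`, whose common fixed vectors are
exactly EPR pairs tensored with some vector (`exists_eq_idealState`). Projecting successively adds
errors in squares, giving distance `O(√n · nε)` (`exists_fixed_of_approx`, `exists_unit_close`),
which is the source of `n^{3/2}`. -/

namespace EPRTest

noncomputable section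

/-! ### Algebra of the controlled-phase gate -/

section Gate

variable {R : Type*} [Ring R] [Algebra ℂ R]

/-- The controlled-phase gate `(1 + a + b - ab) / 2` of two commuting involutions. For `a = X ⊗ σˣ`
and `b = Z ⊗ σᶻ` this is the gate swapping the qubits `(X, Z)` and `(σˣ, σᶻ)`. -/
def phaseGate (a b : R) : R := (1 / 2 : ℂ) • (1 + a + b - a * b)

lemma phaseGate_comm {a b : R} (h : Commute a b) : phaseGate a b = phaseGate b a := by
  unfold phaseGate
  rw [h.eq, add_right_comm]

lemma map_phaseGate {S : Type*} [Ring S] [Algebra ℂ S] (f : R →ₐ[ℂ] S) (a b : R) :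
    f (phaseGate a b) = phaseGate (f a) (f b) := by
  simp [phaseGate]

lemma Commute.phaseGate_right {x a b : R} (ha : Commute x a) (hb : Commute x b) :
    Commute x (phaseGate a b) :=
  ((((Commute.one_right x).add_right ha).add_right hb).sub_right (ha.mul_right hb)).smul_right _

lemma phaseGate_mul_self {a b : R} (haa : a * a = 1) (hbb : b * b = 1) (h : Commute a b) :
    phaseGate a b * phaseGate a b = 1 := by
  have hba : b * a = a * b := h.symm.eq
  have hba' (c : R) : b * (a * c) = a * (b * c) := by rw [← mul_assoc, hba, mul_assoc]
  have haa' (c : R) : a * (a * c) = c := by rw [← mul_assoc, haa, one_mul]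
  simp only [phaseGate, smul_mul_smul_comm, mul_add, add_mul, mul_sub, sub_mul, mul_assoc, hba,
    hba', haa, haa', hbb, mul_one, one_mul]
  module

/-- The gate is `1` where `a = 1` and `b` where `a = -1`. Conjugation therefore fixes `y` on the
first eigenspace and negates it on the second, which is multiplication by `a`. -/
lemma phaseGate_conj {a b y : R} (haa : a * a = 1) (hbb : b * b = 1) (h : Commute a b)
    (hya : Commute a y) (hyb : b * y = -(y * b)) :
    phaseGate a b * y * phaseGate a b = y * a := by
  have hba : b * a = a * b := h.symm.eq
  have hba' (c : R) : b * (a * c) = a * (b * c) := by rw [← mul_assoc, hba, mul_assoc]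
  have haa' (c : R) : a * (a * c) = c := by rw [← mul_assoc, haa, one_mul]
  have hay' (c : R) : a * (y * c) = y * (a * c) := by rw [← mul_assoc, hya.eq, mul_assoc]
  simp only [phaseGate, smul_mul_assoc, mul_smul_comm, mul_add, add_mul, mul_sub, sub_mul,
    mul_assoc, hba, hba', haa, haa', hbb, hyb, hya.eq, hay', mul_one, one_mul, mul_neg, neg_mul]
  module

end Gate

/-! ### Reflections and approximate commutation on a state -/

section Reflections

variable {M : Type*} [NormedAddCommGroup M] [InnerProductSpace ℂ M]

lemma IsReflection.apply_apply {a : Module.End ℂ M} (h : IsReflection a) (v : M) :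
    a (a v) = v := congrArg (· v) h.2

lemma IsReflection.norm_apply {a : Module.End ℂ M} (h : IsReflection a) (v : M) :
    ‖a v‖ = ‖v‖ := by
  have := h.1 v (a v)
  rw [h.apply_apply] at this
  rw [@norm_eq_sqrt_re_inner ℂ, @norm_eq_sqrt_re_inner ℂ, this]

lemma IsReflection.mul {a b : Module.End ℂ M} (ha : IsReflection a) (hb : IsReflection b)
    (h : Commute a b) : IsReflection (a * b) := by
  refine ⟨fun v w => ?_, ?_⟩
  · rw [h.eq]
    change inner ℂ (b (a v)) w = inner ℂ v (b (a w))
    rw [hb.1, ha.1, ← Module.End.mul_apply, ← Module.End.mul_apply, h.eq]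
  · rw [h.symm.mul_mul_mul_comm, ha.2, hb.2, one_mul]

lemma IsReflection.phaseGate {a b : Module.End ℂ M} (ha : IsReflection a) (hb : IsReflection b)
    (h : Commute a b) : IsReflection (phaseGate a b) := by
  refine ⟨?_, phaseGate_mul_self ha.2 hb.2 h⟩
  have hab := (ha.mul hb h).1
  intro v w
  have h1 := ha.1 v w
  have h2 := hb.1 v w
  have h3 := hab v w
  simp only [EPRTest.phaseGate, LinearMap.smul_apply, LinearMap.sub_apply, LinearMap.add_apply,
    Module.End.one_apply, inner_smul_left, inner_smul_right, inner_sub_left, inner_sub_right,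
    inner_add_left, inner_add_right, h1, h2, h3]
  congr 1
  norm_num [Complex.ext_iff]

lemma norm_list_prod_apply {l : List (Module.End ℂ M)} (hl : ∀ a ∈ l, IsReflection a) (v : M) :
    ‖l.prod v‖ = ‖v‖ := by
  induction l with
  | nil => simp
  | cons a l ih =>
    rw [List.prod_cons, Module.End.mul_apply, (hl a (by simp)).norm_apply,
      ih fun b hb => hl b (by simp [hb])]

lemma list_prod_mul_reverse_prod {l : List (Module.End ℂ M)} (hl : ∀ a ∈ l, IsReflection a) :
    l.prod * l.reverse.prod = 1 := by
  induction l with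
  | nil => simp
  | cons a l ih =>
    rw [List.prod_cons, List.reverse_cons, List.prod_append, List.prod_singleton, mul_assoc,
      ← mul_assoc l.prod, ih fun b hb => hl b (by simp [hb]), one_mul, (hl a (by simp)).2]

lemma norm_sub_le_add {M : Type*} [NormedAddCommGroup M] {a b c : M} {x y : ℝ} (h₁ : ‖a - b‖ ≤ x) (h₂ : ‖b - c‖ ≤ y) :
    ‖a - c‖ ≤ x + y := (norm_sub_le_norm_sub_add_norm_sub a b c).trans (add_le_add h₁ h₂)

/-- An operator commuting approximately, on `ψ`, with each of the operators `a k` does so with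
their product, provided each `a k` acts on `ψ` approximately as an operator `b k` commuting with
everything else. -/
lemma norm_commutator_reverse_prod_le {ι : Type*} {a b : ι → Module.End ℂ M} {p : Module.End ℂ M}
    {ψ : M} {δ : ℝ} (hp : IsReflection p) (ha : ∀ k, IsReflection (a k))
    (hb : ∀ k, IsReflection (b k)) (hba : ∀ k i, Commute (b k) (a i))
    (hbp : ∀ k, Commute (b k) p) (hab : ∀ k, ‖a k ψ - b k ψ‖ ≤ δ) (l : List ι)
    (hpa : ∀ k ∈ l, ‖p (a k ψ) - a k (p ψ)‖ ≤ δ) :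
    ‖p ((l.map a).reverse.prod ψ) - (l.map a).reverse.prod (p ψ)‖ ≤ l.length * (3 * δ) := by
  induction l with
  | nil => simp
  | cons k l ih =>
    simp only [List.map_cons, List.reverse_cons, List.prod_append, List.prod_singleton,
      Module.End.mul_apply, List.length_cons, Nat.cast_add, Nat.cast_one]
    set W := (l.map a).reverse.prod with hW
    have hWr : ∀ v, ‖W v‖ = ‖v‖ := norm_list_prod_apply fun x hx => by
      simp only [List.mem_reverse, List.mem_map] at hx
      obtain ⟨i, -, rfl⟩ := hx
      exact ha i
    have hbW : Commute (b k) W := Commute.list_prod_right _ _ fun x hx => by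
      simp only [List.mem_reverse, List.mem_map] at hx
      obtain ⟨i, -, rfl⟩ := hx
      exact hba k i
    have c₁ (v : M) : b k (W v) = W (b k v) := congrArg (· v) hbW.eq
    have c₂ (v : M) : b k (p v) = p (b k v) := congrArg (· v) (hbp k).eq
    -- On `ψ`, with `a`, `b` for `a k`, `b k`: `pWa ≈ pWb = bpW ≈ bWp = Wpb ≈ Wpa ≈ Wap`. The second
    -- approximation is the induction hypothesis; the other three cost `δ` each. Parking `a` as `b`
    -- lets the induction hypothesis be used on `ψ` itself.
    have h₁ : ‖p (W (a k ψ)) - b k (p (W ψ))‖ ≤ δ := by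
      rw [c₂, c₁, ← map_sub, ← map_sub, hp.norm_apply, hWr]
      exact hab k
    have h₂ : ‖b k (p (W ψ)) - b k (W (p ψ))‖ ≤ l.length * (3 * δ) := by
      rw [← map_sub, (hb k).norm_apply]
      exact ih fun i hi => hpa i (by simp [hi])
    have h₃ : ‖b k (W (p ψ)) - W (p (a k ψ))‖ ≤ δ := by
      rw [c₁, c₂, ← map_sub, ← map_sub, hWr, hp.norm_apply, norm_sub_rev]
      exact hab k
    have h₄ : ‖W (p (a k ψ)) - W (a k (p ψ))‖ ≤ δ := by
      rw [← map_sub, hWr]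
      exact hpa k (by simp)
    have := norm_sub_le_add (norm_sub_le_add (norm_sub_le_add h₁ h₂) h₃) h₄
    linarith

/-- The product term is handled by `ab ≈ ad = da ≈ dc = cd` on `ψ` and costs `2ε`; with the two
linear terms and the factor `1/2` this gives `(ε + ε + 2ε)/2`. -/
lemma norm_phaseGate_apply_sub_le {a b c d : Module.End ℂ M} {ψ : M} {ε : ℝ}
    (ha : IsReflection a) (hd : IsReflection d) (had : Commute a d) (hcd : Commute c d)
    (hac : ‖a ψ - c ψ‖ ≤ ε) (hbd : ‖b ψ - d ψ‖ ≤ ε) :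
    ‖phaseGate a b ψ - phaseGate c d ψ‖ ≤ 2 * ε := by
  have h : ‖a (b ψ) - c (d ψ)‖ ≤ ε + ε := by
    have e₁ : a (d ψ) = d (a ψ) := congrArg (· ψ) had.eq
    have e₂ : c (d ψ) = d (c ψ) := congrArg (· ψ) hcd.eq
    refine norm_sub_le_add (b := a (d ψ)) ?_ ?_
    · rwa [← map_sub, ha.norm_apply]
    · rwa [e₁, e₂, ← map_sub, hd.norm_apply]
  have e : phaseGate a b ψ - phaseGate c d ψ =
      (1 / 2 : ℂ) • ((a ψ - c ψ) + (b ψ - d ψ) - (a (b ψ) - c (d ψ))) := by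
    simp only [phaseGate, LinearMap.smul_apply, LinearMap.sub_apply, LinearMap.add_apply,
      Module.End.one_apply, Module.End.mul_apply]
    module
  rw [e, norm_smul]
  have h1 := norm_sub_le (a ψ - c ψ + (b ψ - d ψ)) (a (b ψ) - c (d ψ))
  have h2 := norm_add_le (a ψ - c ψ) (b ψ - d ψ)
  have h3 : ‖(1 / 2 : ℂ)‖ = 1 / 2 := by norm_num
  rw [h3]
  linarith

/-- For the product term, `pab ≈ pad = dpa ≈ dap = apd ≈ apb ≈ abp` on `ψ`, so it costs `4ε`, and
the total is `(ε + ε + 4ε)/2`. -/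
lemma norm_commutator_phaseGate_le {p a b d : Module.End ℂ M} {ψ : M} {ε : ℝ}
    (hp : IsReflection p) (ha : IsReflection a) (hd : IsReflection d)
    (hpd : Commute p d) (had : Commute a d) (hbd : ‖b ψ - d ψ‖ ≤ ε)
    (hpa : ‖p (a ψ) - a (p ψ)‖ ≤ ε) (hpb : ‖p (b ψ) - b (p ψ)‖ ≤ ε) :
    ‖p (phaseGate a b ψ) - phaseGate a b (p ψ)‖ ≤ 3 * ε := by
  have h : ‖p (a (b ψ)) - a (b (p ψ))‖ ≤ ε + ε + ε + ε := by
    have e₁ (v : M) : a (d v) = d (a v) := congrArg (· v) had.eq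
    have e₂ (v : M) : p (d v) = d (p v) := congrArg (· v) hpd.eq
    refine norm_sub_le_add (b := a (p (b ψ))) (norm_sub_le_add (b := d (a (p ψ)))
      (norm_sub_le_add (b := d (p (a ψ))) ?_ ?_) ?_) ?_
    · rwa [← e₂, ← e₁, ← map_sub, ← map_sub, hp.norm_apply, ha.norm_apply]
    · rwa [← map_sub, hd.norm_apply]
    · rwa [← e₁, ← e₂, ← map_sub, ← map_sub, ha.norm_apply, hp.norm_apply, norm_sub_rev]
    · rwa [← map_sub, ha.norm_apply]
  have e : p (phaseGate a b ψ) - phaseGate a b (p ψ) =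
      (1 / 2 : ℂ) • ((p (a ψ) - a (p ψ)) + (p (b ψ) - b (p ψ)) -
        (p (a (b ψ)) - a (b (p ψ)))) := by
    simp only [phaseGate, LinearMap.smul_apply, LinearMap.sub_apply, LinearMap.add_apply,
      Module.End.one_apply, Module.End.mul_apply, map_add, map_sub, map_smul]
    module
  rw [e, norm_smul]
  have h1 := norm_sub_le (p (a ψ) - a (p ψ) + (p (b ψ) - b (p ψ))) (p (a (b ψ)) - a (b (p ψ)))
  have h2 := norm_add_le (p (a ψ) - a (p ψ)) (p (b ψ) - b (p ψ))
  have h3 : ‖(1 / 2 : ℂ)‖ = 1 / 2 := by norm_num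
  rw [h3]
  linarith

end Reflections

/-! ### Swapping the qubits out, one after the other -/

section SwapOut

variable {R : Type*} [Ring R] [Algebra ℂ R]

/-- The gate swapping the `k`-th qubit `(p X k, p Z k)` with the `k`-th qubit `(q X k, q Z k)`. -/
def swapGate {ι : Type*} (p q : Letter → ι → R) (k : ι) : R :=
  phaseGate (p Letter.X k * q Letter.X k) (p Letter.Z k * q Letter.Z k)

lemma map_swapGate {ι S : Type*} [Ring S] [Algebra ℂ S] (f : R →ₐ[ℂ] S) (p q : Letter → ι → R)
    (k : ι) : f (swapGate p q k) = swapGate (fun P i => f (p P i)) (fun P i => f (q P i)) k := by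
  simp [swapGate, map_phaseGate]

/-- The product `S₀ S₁ ⋯ Sₙ₋₁` of swap gates, the inverse of `swapOut`. -/
def swapOutInv {n : ℕ} (p q : Letter → Fin n → R) : R :=
  ((List.finRange n).map (swapGate p q)).prod

/-- The product `Sₙ₋₁ ⋯ S₁ S₀` of swap gates. -/
def swapOut {n : ℕ} (p q : Letter → Fin n → R) : R :=
  ((List.finRange n).map (swapGate p q)).reverse.prod

lemma map_swapOut {n : ℕ} {S : Type*} [Ring S] [Algebra ℂ S] (f : R →ₐ[ℂ] S)
    (p q : Letter → Fin n → R) :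
    f (swapOut p q) = swapOut (fun P i => f (p P i)) (fun P i => f (q P i)) := by
  simp only [swapOut, map_list_prod, List.map_reverse, List.map_map]
  congr 3
  ext k
  exact map_swapGate f p q k

lemma map_swapOutInv {n : ℕ} {S : Type*} [Ring S] [Algebra ℂ S] (f : R →ₐ[ℂ] S)
    (p q : Letter → Fin n → R) :
    f (swapOutInv p q) = swapOutInv (fun P i => f (p P i)) (fun P i => f (q P i)) := by
  simp only [swapOutInv, map_list_prod, List.map_map]
  congr 2
  ext k
  exact map_swapGate f p q k

variable {M : Type*} [NormedAddCommGroup M] [InnerProductSpace ℂ M] {n : ℕ}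

/-- A family of qubits: pairs of anticommuting reflections. -/
structure IsQubitFamily (p : Letter → Fin n → Module.End ℂ M) : Prop where
  reflection : ∀ P j, IsReflection (p P j)
  anticomm : ∀ j, p Letter.X j * p Letter.Z j = -(p Letter.Z j * p Letter.X j)

/-- Every operator of the first family commutes with every operator of the second. -/
def MutuallyCommute (p q : Letter → Fin n → Module.End ℂ M) : Prop :=
  ∀ P i Q j, Commute (p P i) (q Q j)

lemma MutuallyCommute.symm {p q : Letter → Fin n → Module.End ℂ M} (h : MutuallyCommute p q) :
    MutuallyCommute q p := fun P i Q j => (h Q j P i).symm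

section

variable {p q : Letter → Fin n → Module.End ℂ M}

/-- The two anticommutation signs, one from each qubit, cancel. -/
lemma commute_mul_mul_of_anticomm (hp : IsQubitFamily p) (hq : IsQubitFamily q)
    (hpq : MutuallyCommute p q) (k : Fin n) :
    Commute (p Letter.X k * q Letter.X k) (p Letter.Z k * q Letter.Z k) := by
  change _ = _
  rw [(hpq _ _ _ _).symm.mul_mul_mul_comm, hp.anticomm, hq.anticomm, neg_mul_neg,
    (hpq _ _ _ _).mul_mul_mul_comm]

lemma isReflection_mul (hp : IsQubitFamily p) (hq : IsQubitFamily q)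
    (hpq : MutuallyCommute p q) (P : Letter) (k : Fin n) : IsReflection (p P k * q P k) :=
  (hp.reflection P k).mul (hq.reflection P k) (hpq _ _ _ _)

lemma isReflection_swapGate (hp : IsQubitFamily p) (hq : IsQubitFamily q)
    (hpq : MutuallyCommute p q) (k : Fin n) : IsReflection (swapGate p q k) :=
  (isReflection_mul hp hq hpq _ k).phaseGate (isReflection_mul hp hq hpq _ k)
    (commute_mul_mul_of_anticomm hp hq hpq k)

lemma swapGate_conj (hp : IsQubitFamily p) (hq : IsQubitFamily q)
    (hpq : MutuallyCommute p q) (P : Letter) (k : Fin n) :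
    swapGate p q k * q P k * swapGate p q k = p P k := by
  have hr := fun P => isReflection_mul hp hq hpq P k
  have hc := commute_mul_mul_of_anticomm hp hq hpq k
  have hself (P) : Commute (p P k * q P k) (q P k) := (hpq _ _ _ _).mul_left (Commute.refl _)
  have hfin (P) : q P k * (p P k * q P k) = p P k := by
    rw [← (hself P).eq, mul_assoc, (hq.reflection P k).2, mul_one]
  cases P with
  | X =>
    refine (phaseGate_conj (hr _).2 (hr _).2 hc (hself _) ?_).trans (hfin _)
    rw [mul_assoc, ← neg_eq_iff_eq_neg.2 (hq.anticomm k), mul_neg, ← mul_assoc, ← mul_assoc,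
      (hpq _ _ _ _).eq]
  -- The gate is symmetric in its two arguments, so `Z` is treated as `X` with their roles
  -- exchanged.
  | Z =>
    rw [swapGate, phaseGate_comm hc]
    refine (phaseGate_conj (hr _).2 (hr _).2 hc.symm (hself _) ?_).trans (hfin _)
    rw [mul_assoc, hq.anticomm k, mul_neg, ← mul_assoc, ← mul_assoc, (hpq _ _ _ _).eq]

lemma forall_mem_map_swapGate (hp : IsQubitFamily p) (hq : IsQubitFamily q)
    (hpq : MutuallyCommute p q) (l : List (Fin n)) :
    ∀ a ∈ l.map (swapGate p q), IsReflection a := by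
  intro a ha
  obtain ⟨k, -, rfl⟩ := List.mem_map.1 ha
  exact isReflection_swapGate hp hq hpq k

lemma forall_mem_map_swapGate_reverse (hp : IsQubitFamily p) (hq : IsQubitFamily q)
    (hpq : MutuallyCommute p q) (l : List (Fin n)) :
    ∀ a ∈ (l.map (swapGate p q)).reverse, IsReflection a := by
  intro a ha
  exact forall_mem_map_swapGate hp hq hpq l a (List.mem_reverse.1 ha)

lemma swapOutInv_mul_swapOut (hp : IsQubitFamily p) (hq : IsQubitFamily q)
    (hpq : MutuallyCommute p q) : swapOutInv p q * swapOut p q = 1 :=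
  list_prod_mul_reverse_prod (forall_mem_map_swapGate hp hq hpq _)

lemma swapOut_mul_swapOutInv (hp : IsQubitFamily p) (hq : IsQubitFamily q)
    (hpq : MutuallyCommute p q) : swapOut p q * swapOutInv p q = 1 := by
  have := list_prod_mul_reverse_prod (forall_mem_map_swapGate_reverse hp hq hpq (List.finRange n))
  rwa [List.reverse_reverse] at this

/-- The unitary swapping the qubits `p` out into the qubits `q`, one after the other. -/
def swapOutEquiv (hp : IsQubitFamily p) (hq : IsQubitFamily q)
    (hpq : MutuallyCommute p q) : M ≃ₗᵢ[ℂ] M where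
  toLinearEquiv := LinearEquiv.ofLinearMap (swapOut p q) (swapOutInv p q)
    (swapOut_mul_swapOutInv hp hq hpq) (swapOutInv_mul_swapOut hp hq hpq)
  norm_map' := norm_list_prod_apply (forall_mem_map_swapGate_reverse hp hq hpq _)

/-- Conjugation with the swaps turns the qubit `q j` into the qubit `p j`, conjugated with the
swaps of smaller index. -/
lemma swapOut_conj (hp : IsQubitFamily p) (hq : IsQubitFamily q)
    (hpq : MutuallyCommute p q) (hqq : ∀ P Q i j, i ≠ j → Commute (q P i) (q Q j)) (P : Letter) (j : Fin n) :
    ∃ l : List (Fin n), l.length ≤ n ∧ j ∉ l ∧ swapOutInv p q * q P j * swapOut p q =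
      (l.map (swapGate p q)).prod * p P j * (l.map (swapGate p q)).reverse.prod := by
  -- `l₁` lists the indices before `j` and `l₂` those after it.
  obtain ⟨l₁, l₂, hl⟩ := List.append_of_mem (List.mem_finRange j)
  have hnd := List.nodup_finRange n
  have hlen := List.length_finRange (n := n)
  rw [hl] at hnd hlen
  have hj₂ : j ∉ l₂ := (List.nodup_cons.1 (List.nodup_append.1 hnd).2.1).1
  have hj₁ : j ∉ l₁ := fun h => (List.nodup_append.1 hnd).2.2 j h j (by simp) rfl
  refine ⟨l₁, ?_, hj₁, ?_⟩
  · rw [List.length_append] at hlen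
    omega
  -- The gates after `j` commute exactly with `q P j`, so they cancel in the conjugation.
  have hc : Commute (q P j) (l₂.map (swapGate p q)).prod :=
    Commute.list_prod_right _ _ fun a ha => by
      obtain ⟨k, hk, rfl⟩ := List.mem_map.1 ha
      have hjk : j ≠ k := fun h => hj₂ (h ▸ hk)
      exact Commute.phaseGate_right ((hpq _ _ _ _).symm.mul_right (hqq _ _ _ _ hjk))
        ((hpq _ _ _ _).symm.mul_right (hqq _ _ _ _ hjk))
  have h₁ := list_prod_mul_reverse_prod (forall_mem_map_swapGate hp hq hpq l₂)
  rw [swapOut, swapOutInv, hl]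
  simp only [List.map_append, List.map_cons, List.prod_append, List.prod_cons,
    List.reverse_append, List.reverse_cons]
  rw [← swapGate_conj hp hq hpq P j]
  set V₁ := (l₁.map (swapGate p q)).prod
  set V₂ := (l₂.map (swapGate p q)).prod
  set W₂ := (l₂.map (swapGate p q)).reverse.prod
  set S := swapGate p q j
  calc _ = V₁ * (S * (V₂ * q P j * W₂) * S) * (l₁.map (swapGate p q)).reverse.prod := by
        simp only [List.prod_nil, mul_assoc, one_mul]
    _ = _ := by rw [← hc.eq, mul_assoc (q P j), h₁, mul_one]

end

/-- On a state on which the qubits `q` and `r` agree, the qubits `p` and `s` agree approximately,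
and the qubits `p` are approximately independent, the qubits obtained by swapping `p` out into `q`
are close to `p`. -/
lemma norm_swapOut_conj_sub_le {p q r s : Letter → Fin n → Module.End ℂ M} {ψ : M} {ε : ℝ}
    (hε : 0 ≤ ε)
    (hp : IsQubitFamily p) (hq : IsQubitFamily q) (hr : IsQubitFamily r) (hs : IsQubitFamily s)
    (hpq : MutuallyCommute p q) (hpr : MutuallyCommute p r) (hps : MutuallyCommute p s)
    (hqr : MutuallyCommute q r) (hqs : MutuallyCommute q s) (hsr : MutuallyCommute s r)
    (hqq : ∀ P Q i j, i ≠ j → Commute (q P i) (q Q j))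
    (hqr_eq : ∀ P j, q P j ψ = r P j ψ) (hps_le : ∀ P j, ‖p P j ψ - s P j ψ‖ ≤ ε)
    (hpp : ∀ P Q i j, i ≠ j → ‖p P i (p Q j ψ) - p Q j (p P i ψ)‖ ≤ ε) (P : Letter) (j : Fin n) :
    ‖swapOutInv p q (q P j (swapOut p q ψ)) - p P j ψ‖ ≤ n * (9 * ε) := by
  obtain ⟨l, hl, hjl, he⟩ := swapOut_conj hp hq hpq hqq P j
  have he' : swapOutInv p q (q P j (swapOut p q ψ)) = (l.map (swapGate p q)).prod
      (p P j ((l.map (swapGate p q)).reverse.prod ψ)) := congrArg (· ψ) he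
  have hVW : (l.map (swapGate p q)).prod ((l.map (swapGate p q)).reverse.prod (p P j ψ)) = p P j ψ :=
    congrArg (· (p P j ψ)) (list_prod_mul_reverse_prod (forall_mem_map_swapGate hp hq hpq l))
  -- Writing `p P j ψ` as `V W (p P j ψ)` and dropping the isometry `V` leaves the commutator of `p
  -- P j` with `W` on `ψ`.
  rw [he', ← congrArg (fun x => ‖_ - x‖) hVW, ← map_sub, norm_list_prod_apply (forall_mem_map_swapGate hp hq hpq l)]
  have hpq_sr (Q R i k) : Commute (p Q i * q Q i) (s R k * r R k) :=
    ((hps _ _ _ _).mul_right (hpr _ _ _ _)).mul_left ((hqs _ _ _ _).mul_right (hqr _ _ _ _))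
  have hmove (Q i) : ‖(p Q i * q Q i) ψ - (s Q i * r Q i) ψ‖ ≤ ε := by
    have e₁ : p Q i (r Q i ψ) = r Q i (p Q i ψ) := congrArg (· ψ) (hpr _ _ _ _).eq
    have e₂ : s Q i (r Q i ψ) = r Q i (s Q i ψ) := congrArg (· ψ) (hsr _ _ _ _).eq
    rw [Module.End.mul_apply, Module.End.mul_apply, hqr_eq, e₁, e₂, ← map_sub,
      (hr.reflection _ _).norm_apply]
    exact hps_le Q i
  have hcomm (Q k) (hk : j ≠ k) :
      ‖p P j ((p Q k * q Q k) ψ) - (p Q k * q Q k) (p P j ψ)‖ ≤ ε := by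
    have e (v : M) (R : Letter) (i : Fin n) : p R i (q Q k v) = q Q k (p R i v) :=
      congrArg (· v) (hpq _ _ _ _).eq
    simp only [Module.End.mul_apply, e]
    rw [← map_sub, (hq.reflection _ _).norm_apply]
    exact hpp _ _ _ _ hk
  -- Each gate is parked as `swapGate s r`, which commutes with all of `p` and `q`. Parking costs
  -- `2ε` and commuting past one gate `3ε`, so `δ = 3ε` serves for both.
  have key := norm_commutator_reverse_prod_le (a := swapGate p q) (b := swapGate s r)
    (p := p P j) (ψ := ψ) (δ := 3 * ε) (hp.reflection P j) (isReflection_swapGate hp hq hpq)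
    (isReflection_swapGate hs hr hsr)
    (fun k i => Commute.phaseGate_right
      (Commute.phaseGate_right (hpq_sr _ _ _ _) (hpq_sr _ _ _ _)).symm
      (Commute.phaseGate_right (hpq_sr _ _ _ _) (hpq_sr _ _ _ _)).symm)
    (fun k => (Commute.phaseGate_right ((hps _ _ _ _).mul_right (hpr _ _ _ _))
      ((hps _ _ _ _).mul_right (hpr _ _ _ _))).symm)
    (fun k => (norm_phaseGate_apply_sub_le (isReflection_mul hp hq hpq _ _)
      (isReflection_mul hs hr hsr _ _) (hpq_sr _ _ _ _) (commute_mul_mul_of_anticomm hs hr hsr k)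
      (hmove _ _) (hmove _ _)).trans (by linarith)) l
    (fun k hk => by
      have hjk : j ≠ k := fun h => hjl (h ▸ hk)
      exact norm_commutator_phaseGate_le (d := s Letter.Z k * r Letter.Z k) (hp.reflection _ _)
        (isReflection_mul hp hq hpq _ _) (isReflection_mul hs hr hsr _ _)
        ((hps _ _ _ _).mul_right (hpr _ _ _ _)) (hpq_sr _ _ _ _) (hmove _ _)
        (hcomm _ _ hjk) (hcomm _ _ hjk))
  refine key.trans ?_
  have : (l.length : ℝ) ≤ n := by exact_mod_cast hl
  nlinarith

end SwapOut
-- Operators on one tensor factor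
section Tensor

variable {E F : Type*} [NormedAddCommGroup E] [InnerProductSpace ℂ E]
  [NormedAddCommGroup F] [InnerProductSpace ℂ F]

variable (E F) in
/-- `onFst` as a homomorphism of algebras. -/
def onFstHom : Module.End ℂ E →ₐ[ℂ] Module.End ℂ (E ⊗[ℂ] F) := Module.End.rTensorAlgHom ℂ E F

variable (E F) in
/-- `onSnd` as a homomorphism of algebras. -/
def onSndHom : Module.End ℂ F →ₐ[ℂ] Module.End ℂ (E ⊗[ℂ] F) := Module.End.lTensorAlgHom ℂ F E

lemma onFstHom_apply (T : Module.End ℂ E) : onFstHom E F T = onFst F T := rfl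

lemma onSndHom_apply (T : Module.End ℂ F) : onSndHom E F T = onSnd E T := rfl

lemma commute_onFst_onSnd (S : Module.End ℂ E) (T : Module.End ℂ F) :
    Commute (onFst F S) (onSnd E T) := by
  change _ * _ = _ * _
  rw [Module.End.mul_eq_comp, Module.End.mul_eq_comp, ← TensorProduct.map_comp,
    ← TensorProduct.map_comp]
  rfl

lemma Commute.onFst {S T : Module.End ℂ E} (h : Commute S T) : Commute (onFst F S) (onFst F T) :=
  h.map (onFstHom E F)

lemma Commute.onSnd {S T : Module.End ℂ F} (h : Commute S T) : Commute (onSnd E S) (onSnd E T) :=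
  h.map (onSndHom E F)

lemma isSymmetric_map {S : Module.End ℂ E} {T : Module.End ℂ F} (hS : S.IsSymmetric)
    (hT : T.IsSymmetric) : (TensorProduct.map S T).IsSymmetric := by
  intro x y
  induction x with
  | zero => simp
  | add x x' hx hx' => rw [map_add, inner_add_left, inner_add_left, hx, hx']
  | tmul a b =>
    induction y with
    | zero => simp
    | add y y' hy hy' => rw [map_add, inner_add_right, inner_add_right, hy, hy']
    | tmul c d => simp [hS a c, hT b d]

lemma IsReflection.onFst {S : Module.End ℂ E} (h : IsReflection S) :
    IsReflection (onFst F S) :=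
  ⟨isSymmetric_map h.1 fun _ _ => rfl, by
    rw [← onFstHom_apply, ← map_mul, h.2, map_one]⟩

lemma IsReflection.onSnd {T : Module.End ℂ F} (h : IsReflection T) :
    IsReflection (onSnd E T) :=
  ⟨isSymmetric_map (fun _ _ => rfl) h.1, by
    rw [← onSndHom_apply, ← map_mul, h.2, map_one]⟩

variable {n : ℕ}

lemma IsQubitFamily.onFst {p : Letter → Fin n → Module.End ℂ E} (h : IsQubitFamily p) :
    IsQubitFamily fun P j => onFst F (p P j) :=
  ⟨fun P j => (h.reflection P j).onFst, fun j => by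
    simp only [← onFstHom_apply, ← map_mul, h.anticomm, map_neg]⟩

lemma IsQubitFamily.onSnd {p : Letter → Fin n → Module.End ℂ F} (h : IsQubitFamily p) :
    IsQubitFamily fun P j => onSnd E (p P j) :=
  ⟨fun P j => (h.reflection P j).onSnd, fun j => by
    simp only [← onSndHom_apply, ← map_mul, h.anticomm, map_neg]⟩

lemma MutuallyCommute.onFst {p q : Letter → Fin n → Module.End ℂ E} (h : MutuallyCommute p q) :
    MutuallyCommute (fun P j => onFst F (p P j)) (fun P j => onFst F (q P j)) :=
  fun P i Q j => Commute.onFst (h P i Q j)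

lemma MutuallyCommute.onSnd {p q : Letter → Fin n → Module.End ℂ F} (h : MutuallyCommute p q) :
    MutuallyCommute (fun P j => onSnd E (p P j)) (fun P j => onSnd E (q P j)) :=
  fun P i Q j => Commute.onSnd (h P i Q j)

lemma mutuallyCommute_onFst_onSnd (p : Letter → Fin n → Module.End ℂ E)
    (q : Letter → Fin n → Module.End ℂ F) :
    MutuallyCommute (fun P j => onFst F (p P j)) (fun P j => onSnd E (q P j)) :=
  fun _ _ _ _ => commute_onFst_onSnd _ _

end Tensor

/-! ### Pauli operators and EPR pairs in coordinates -/

section Qubits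

variable {ι : Type} [Fintype ι] [DecidableEq ι]

lemma onQubit_apply (M : Matrix (Fin 2) (Fin 2) ℂ) (j : ι) (v : Qubits ι) (x : ι → Fin 2) :
    onQubit M j v x = ∑ b : Fin 2, M (x j) b * v (Function.update x j b) := rfl

lemma onQubit_mul (M N : Matrix (Fin 2) (Fin 2) ℂ) (j : ι) :
    onQubit M j * onQubit N j = onQubit (M * N) j := by
  ext v x
  simp only [Module.End.mul_apply, onQubit_apply, Function.update_self, Function.update_idem,
    Matrix.mul_apply, Finset.mul_sum, Finset.sum_mul, mul_assoc]
  exact Finset.sum_comm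

lemma onQubit_one (j : ι) : onQubit (1 : Matrix (Fin 2) (Fin 2) ℂ) j = 1 := by
  ext v x
  simp [onQubit_apply, Matrix.one_apply]

lemma onQubit_neg (M : Matrix (Fin 2) (Fin 2) ℂ) (j : ι) : onQubit (-M) j = -onQubit M j := by
  ext v x
  simp [onQubit_apply]

lemma commute_onQubit (M N : Matrix (Fin 2) (Fin 2) ℂ) {i j : ι} (h : i ≠ j) :
    Commute (onQubit M i) (onQubit N j) := by
  change _ * _ = _ * _
  ext v x
  simp only [Module.End.mul_apply, onQubit_apply, Function.update_of_ne h,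
    Function.update_of_ne h.symm, Finset.mul_sum]
  rw [Finset.sum_comm]
  refine Finset.sum_congr rfl fun b _ => Finset.sum_congr rfl fun c _ => ?_
  rw [Function.update_comm h, mul_left_comm]

lemma isSymmetric_onQubit {M : Matrix (Fin 2) (Fin 2) ℂ} (hM : M.IsHermitian) (j : ι) :
    (onQubit M j).IsSymmetric := by
  intro v w
  simp only [PiLp.inner_apply, onQubit_apply, RCLike.inner_apply, map_sum, map_mul,
    Finset.mul_sum, Finset.sum_mul]
  rw [← Fintype.sum_prod_type', ← Fintype.sum_prod_type']
  -- Exchanging the `j`-th bit with the summed bit is an involution that matches the two double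
  -- sums; the matrix entries then agree by hermiticity.
  let f : (ι → Fin 2) × Fin 2 → (ι → Fin 2) × Fin 2 := fun p => (Function.update p.1 j p.2, p.1 j)
  have hf : Function.Involutive f := fun p => by simp [f]
  rw [← Equiv.sum_comp (hf.toPerm f)]
  refine Finset.sum_congr rfl fun p _ => ?_
  have := hM.apply (p.1 j) p.2
  simp only [Complex.star_def] at this
  simp [f, this]
  ring

lemma pauli_isHermitian (P : Letter) : (pauli P).IsHermitian := by
  cases P <;> ext i j <;> fin_cases i <;> fin_cases j <;> simp [pauli]

lemma pauli_mul_self (P : Letter) : pauli P * pauli P = 1 := by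
  cases P <;> ext i j <;> fin_cases i <;> fin_cases j <;> simp [pauli]

lemma pauli_anticomm :
    pauli Letter.X * pauli Letter.Z = -(pauli Letter.Z * pauli Letter.X) := by
  ext i j
  fin_cases i <;> fin_cases j <;> simp [pauli]

lemma isReflection_onQubit_pauli (P : Letter) (j : ι) : IsReflection (onQubit (pauli P) j) :=
  ⟨isSymmetric_onQubit (pauli_isHermitian P) j, by rw [onQubit_mul, pauli_mul_self, onQubit_one]⟩

lemma isQubitFamily_onQubit {n : ℕ} (f : Fin n → ι) :
    IsQubitFamily fun P j => onQubit (pauli P) (f j) :=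
  ⟨fun P j => isReflection_onQubit_pauli P (f j), fun j => by
    rw [onQubit_mul, onQubit_mul, pauli_anticomm, onQubit_neg]⟩

lemma onQubit_ket (M : Matrix (Fin 2) (Fin 2) ℂ) (j : ι) (x : ι → Fin 2) :
    onQubit M j (ket x) = ∑ b : Fin 2, M b (x j) • ket (Function.update x j b) := by
  have hiff (y : ι → Fin 2) (b : Fin 2) :
      Function.update y j b = x ↔ (∀ i, i ≠ j → y i = x i) ∧ b = x j := by
    rw [Function.update_eq_iff]
    tauto
  have hiff' (y : ι → Fin 2) (b : Fin 2) :
      y = Function.update x j b ↔ (∀ i, i ≠ j → y i = x i) ∧ b = y j := by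
    rw [Function.eq_update_iff]
    tauto
  ext y
  simp only [onQubit_apply, ket, PiLp.single_apply, hiff, WithLp.ofLp_sum, WithLp.ofLp_smul,
    Finset.sum_apply, Pi.smul_apply, hiff', smul_eq_mul, mul_ite, mul_one, mul_zero]
  by_cases h : ∀ i, i ≠ j → y i = x i 
  · simp only [eq_true h, true_and]
    simp
  · simp only [eq_false h, false_and, if_false]

/-- Only the `j`-th factor of the amplitude is affected, and on one EPR pair an operator on one half
equals its transpose on the other; both Pauli matrices are symmetric. -/
lemma onQubit_eprLocal (P : Letter) {n : ℕ} (j : Fin n) :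
    onQubit (pauli P) (j, 0) (eprLocal n) = onQubit (pauli P) (j, 1) (eprLocal n) := by
  have hupd (x : Fin n × Fin 2 → Fin 2) (k b : Fin 2) :
      ∏ i ∈ Finset.univ.erase j, eprAmp (Function.update x (j, k) b (i, 0))
        (Function.update x (j, k) b (i, 1)) =
      ∏ i ∈ Finset.univ.erase j, eprAmp (x (i, 0)) (x (i, 1)) := by
    refine Finset.prod_congr rfl fun i hi => ?_
    have hij : i ≠ j := Finset.ne_of_mem_erase hi
    simp [hij]
  ext x
  have h₀ (b : Fin 2) : eprLocal n (Function.update x (j, 0) b) = eprAmp b (x (j, 1)) *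
      ∏ i ∈ Finset.univ.erase j, eprAmp (x (i, 0)) (x (i, 1)) := by
    rw [← hupd x 0 b]
    exact (Finset.mul_prod_erase _ _ (Finset.mem_univ j)).symm.trans (by simp)
  have h₁ (b : Fin 2) : eprLocal n (Function.update x (j, 1) b) = eprAmp (x (j, 0)) b *
      ∏ i ∈ Finset.univ.erase j, eprAmp (x (i, 0)) (x (i, 1)) := by
    rw [← hupd x 1 b]
    exact (Finset.mul_prod_erase _ _ (Finset.mem_univ j)).symm.trans (by simp)
  simp only [onQubit_apply, h₀, h₁]
  generalize x (j, 0) = a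
  generalize x (j, 1) = c
  cases P <;> fin_cases a <;> fin_cases c <;> simp [pauli, eprAmp]

lemma norm_eprLocal (n : ℕ) : ‖eprLocal n‖ = 1 := by
  rw [EuclideanSpace.norm_eq, Real.sqrt_eq_one]
  have h (x : Fin n × Fin 2 → Fin 2) : ‖eprLocal n x‖ ^ 2 =
      ∏ j, (fun y : Fin 2 → Fin 2 => ‖eprAmp (y 0) (y 1)‖ ^ 2)
        (Equiv.curry (Fin n) (Fin 2) (Fin 2) x j) := by
    change ‖∏ j : Fin n, eprAmp (x (j, 0)) (x (j, 1))‖ ^ 2 = _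
    rw [norm_prod, ← Finset.prod_pow]
    rfl
  simp only [h]
  -- The sum over bit strings factors into one sum for each pair, and each of these is `1`.
  rw [(Equiv.curry (Fin n) (Fin 2) (Fin 2)).sum_comp
    (fun f => ∏ j, (fun y : Fin 2 → Fin 2 => ‖eprAmp (y 0) (y 1)‖ ^ 2) (f j)),
    ← Fintype.prod_sum (fun (_ : Fin n) (y : Fin 2 → Fin 2) => ‖eprAmp (y 0) (y 1)‖ ^ 2),
    Finset.prod_eq_one]
  intro j _
  rw [← (finTwoArrowEquiv (Fin 2)).symm.sum_comp, Fintype.sum_prod_type]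
  simp [eprAmp]
  norm_num

end Qubits

/-! ### Separating the swapped ancillas from the residual space -/

section Split

/-- Separating the two halves of a register of pairs of bits. -/
def bitsEquiv (ι : Type) : (ι × Fin 2 → Fin 2) ≃ (ι → Fin 2) × (ι → Fin 2) where
  toFun x := (fun j => x (j, 1), fun j => x (j, 0))
  invFun y p := if p.2 = 0 then y.2 p.1 else y.1 p.1
  left_inv x := by
    ext ⟨i, k⟩
    fin_cases k <;> simp
  right_inv y := by simp

/-- Separating the two halves of a register of pairs of qubits; the qubits `(j, 1)` come first. -/
def splitQubits (n : ℕ) : Qubits (Fin n × Fin 2) ≃ₗᵢ[ℂ] Qubits (Fin n) ⊗[ℂ] Qubits (Fin n) :=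
  (EuclideanSpace.basisFun (Fin n × Fin 2 → Fin 2) ℂ).equiv
    ((EuclideanSpace.basisFun (Fin n → Fin 2) ℂ).tensorProduct
      (EuclideanSpace.basisFun (Fin n → Fin 2) ℂ)) (bitsEquiv (Fin n))

lemma splitQubits_ket {n : ℕ} (x : Fin n × Fin 2 → Fin 2) :
    splitQubits n (ket x) = ket (fun j => x (j, 1)) ⊗ₜ[ℂ] ket (fun j => x (j, 0)) := by
  have : ket x = EuclideanSpace.basisFun (Fin n × Fin 2 → Fin 2) ℂ x := by simp [ket]
  rw [this, splitQubits, OrthonormalBasis.equiv_apply_basis]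
  simp [bitsEquiv, ket]

lemma ext_ket {ι : Type} [Fintype ι] [DecidableEq ι] {V : Type*} [AddCommGroup V] [Module ℂ V]
    {f g : Qubits ι →ₗ[ℂ] V} (h : ∀ x, f (ket x) = g (ket x)) : f = g :=
  (EuclideanSpace.basisFun (ι → Fin 2) ℂ).toBasis.ext fun x => by simpa [ket] using h x

lemma splitQubits_onQubit {n : ℕ} (M : Matrix (Fin 2) (Fin 2) ℂ) (j : Fin n)
    (v : Qubits (Fin n × Fin 2)) :
    splitQubits n (onQubit M (j, 0) v) = onSnd (Qubits (Fin n)) (onQubit M j) (splitQubits n v) := by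
  have : (splitQubits n).toLinearEquiv.toLinearMap ∘ₗ onQubit M (j, 0) =
      onSnd (Qubits (Fin n)) (onQubit M j) ∘ₗ (splitQubits n).toLinearEquiv.toLinearMap := by
    refine ext_ket fun x => ?_
    change splitQubits n (onQubit M (j, 0) (ket x)) =
      onSnd (Qubits (Fin n)) (onQubit M j) (splitQubits n (ket x))
    have h₁ (b : Fin 2) : (fun i => Function.update x (j, 0) b (i, 1)) = fun i => x (i, 1) := by
      ext i
      simp
    have h₀ (b : Fin 2) : (fun i => Function.update x (j, 0) b (i, 0)) =
        Function.update (fun i => x (i, 0)) j b := by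
      ext i
      by_cases h : i = j
      · subst h
        simp
      · simp [h]
    simp only [onQubit_ket, splitQubits_ket, map_sum, map_smul, h₁, h₀, TensorProduct.map_tmul,
      LinearMap.id_apply, TensorProduct.tmul_sum, TensorProduct.tmul_smul]
  exact congrArg (· v) this

variable (H : Type*) [NormedAddCommGroup H] [InnerProductSpace ℂ H] [FiniteDimensional ℂ H]

/-- The dimension of `H` together with `n` qubits. -/
abbrev residualDim (n : ℕ) : ℕ := Module.finrank ℂ (H ⊗[ℂ] Qubits (Fin n))

/-- Bringing the qubits `(j, 0)` to the front, and choosing coordinates on the remaining space. -/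
def extractQubits (n : ℕ) : (H ⊗[ℂ] Qubits (Fin n × Fin 2)) ≃ₗᵢ[ℂ]
    (Qubits (Fin n) ⊗[ℂ] EuclideanSpace ℂ (Fin (residualDim H n))) :=
  (((splitQubits n).lTensor H).trans
    (TensorProduct.assocIsometry ℂ H (Qubits (Fin n)) (Qubits (Fin n))).symm).trans
    ((TensorProduct.commIsometry ℂ (H ⊗[ℂ] Qubits (Fin n)) (Qubits (Fin n))).trans
      ((stdOrthonormalBasis ℂ (H ⊗[ℂ] Qubits (Fin n))).repr.lTensor (Qubits (Fin n))))

variable {H}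

lemma extractQubits_tmul {n : ℕ} (h : H) (w : Qubits (Fin n × Fin 2)) :
    extractQubits H n (h ⊗ₜ[ℂ] w) = (stdOrthonormalBasis ℂ (H ⊗[ℂ] Qubits (Fin n))).repr.lTensor _
      (TensorProduct.comm ℂ _ _ ((TensorProduct.assoc ℂ H _ _).symm
        (h ⊗ₜ[ℂ] splitQubits n w))) := rfl

/-- The residual space is `H` with the EPR partners `(j, 1)`, so the ancillas `(j, 0)` become the
output qubits. -/
lemma extractQubits_onQubit {n : ℕ} (M : Matrix (Fin 2) (Fin 2) ℂ) (j : Fin n)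
    (v : H ⊗[ℂ] Qubits (Fin n × Fin 2)) :
    extractQubits H n (onSnd H (onQubit M (j, 0)) v) =
      onFst (EuclideanSpace ℂ (Fin (residualDim H n))) (onQubit M j) (extractQubits H n v) := by
  induction v with
  | zero => simp
  | add v w hv hw => simp only [map_add, hv, hw]
  | tmul h w =>
    rw [TensorProduct.map_tmul, LinearMap.id_apply, extractQubits_tmul, extractQubits_tmul,
      splitQubits_onQubit]
    generalize splitQubits n w = u
    induction u with
    | zero => simp
    | add u u' hu hu' => simp only [map_add, TensorProduct.tmul_add, hu, hu']
    | tmul a b => simp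

end Split
-- From approximately to exactly fixed vectors
section Stabilizer

variable {M : Type*} [NormedAddCommGroup M] [InnerProductSpace ℂ M]

/-- The projection onto the fixed vectors of a reflection. -/
def fixedProj (a : Module.End ℂ M) : Module.End ℂ M := (1 / 2 : ℂ) • (1 + a)

lemma IsReflection.apply_fixedProj {a : Module.End ℂ M} (ha : IsReflection a) :
    a * fixedProj a = fixedProj a := by
  rw [fixedProj, mul_smul_comm, mul_add, ha.2, mul_one, add_comm]

lemma norm_sub_fixedProj (a : Module.End ℂ M) (v : M) :
    ‖v - fixedProj a v‖ = ‖a v - v‖ / 2 := by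
  have : v - fixedProj a v = (1 / 2 : ℂ) • (v - a v) := by
    simp only [fixedProj, LinearMap.smul_apply, LinearMap.add_apply, Module.End.one_apply]
    module
  rw [this, norm_smul, norm_sub_rev]
  norm_num
  ring

lemma norm_fixedProj_le {a : Module.End ℂ M} (ha : IsReflection a) (v : M) :
    ‖fixedProj a v‖ ≤ ‖v‖ := by
  simp only [fixedProj, LinearMap.smul_apply, LinearMap.add_apply, Module.End.one_apply, norm_smul]
  have := norm_add_le v (a v)
  rw [ha.norm_apply] at this
  norm_num
  linarith

/-- With `Q` the projection, `u - Qw = (u - Qu) + Q(u - w)` is an orthogonal sum. Adding squares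
here makes `m` projections cost `√m` rather than `m`. -/
lemma norm_sub_fixedProj_apply_sq_le {a : Module.End ℂ M} (ha : IsReflection a) (u w : M) :
    ‖u - fixedProj a w‖ ^ 2 ≤ ‖u - fixedProj a u‖ ^ 2 + ‖u - w‖ ^ 2 := by
  have e : u - fixedProj a w = (u - fixedProj a u) + fixedProj a (u - w) := by
    rw [map_sub]
    abel
  have h : inner ℂ (u - fixedProj a u) (fixedProj a (u - w)) = 0 := by
    have e₁ : u - fixedProj a u = (1 / 2 : ℂ) • (u - a u) := by
      simp only [fixedProj, LinearMap.smul_apply, LinearMap.add_apply, Module.End.one_apply]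
      module
    rw [e₁, fixedProj, LinearMap.smul_apply, LinearMap.add_apply, Module.End.one_apply,
      inner_smul_left, inner_smul_right, inner_sub_left, inner_add_right, inner_add_right,
      ha.1, ha.1, ha.apply_apply]
    ring
  have hp := norm_fixedProj_le ha (u - w)
  have := norm_add_sq_eq_norm_sq_add_norm_sq_of_inner_eq_zero _ _ h
  rw [e]
  nlinarith [norm_nonneg (fixedProj a (u - w)), this]

/-- A vector approximately fixed by commuting reflections is close to a vector fixed by all of
them. -/
lemma exists_fixed_of_approx {l : List (Module.End ℂ M)} (hl : ∀ a ∈ l, IsReflection a)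
    (hc : ∀ a ∈ l, ∀ b ∈ l, Commute a b) {φ : M} {δ : ℝ} (hδ : ∀ a ∈ l, ‖a φ - φ‖ ≤ δ) :
    ∃ χ : M, (∀ a ∈ l, a χ = χ) ∧ ‖φ - χ‖ ^ 2 ≤ l.length * (δ / 2) ^ 2 := by
  induction l with
  | nil => exact ⟨φ, by simp⟩
  | cons a l ih =>
    obtain ⟨χ, hχ, hle⟩ := ih (fun b hb => hl b (by simp [hb]))
      (fun b hb c hc' => hc b (by simp [hb]) c (by simp [hc'])) (fun b hb => hδ b (by simp [hb]))
    have ha := hl a (by simp)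
    -- The projection commutes with the other reflections, so it preserves the relations already
    -- achieved.
    refine ⟨fixedProj a χ, ?_, ?_⟩
    · intro b hb
      rcases List.mem_cons.1 hb with rfl | hb'
      · exact congrArg (· χ) ha.apply_fixedProj
      · have hba : Commute b a := hc b hb a (by simp)
        have hbp : Commute b (fixedProj a) := ((Commute.one_right b).add_right hba).smul_right _
        have : b (fixedProj a χ) = fixedProj a (b χ) := congrArg (· χ) hbp.eq
        rw [this, hχ b hb']
    · have h₁ := norm_sub_fixedProj_apply_sq_le ha φ χ
      have h₂ := hδ a (by simp)
      rw [norm_sub_fixedProj] at h₁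
      have h₃ : (‖a φ - φ‖ / 2) ^ 2 ≤ (δ / 2) ^ 2 := by gcongr
      rw [List.length_cons]
      push_cast
      linarith

end Stabilizer

/-! ### Components of a vector along computational basis states -/

section Slices

variable {ι : Type} [Fintype ι] {K L : Type*} [NormedAddCommGroup K] [InnerProductSpace ℂ K]
  [NormedAddCommGroup L] [InnerProductSpace ℂ L]

/-- The linear map `⟨x| ⊗ 1`. -/
def slice (K : Type*) [NormedAddCommGroup K] [InnerProductSpace ℂ K] (x : ι → Fin 2) :
    Qubits ι ⊗[ℂ] K →ₗ[ℂ] K :=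
  (TensorProduct.lid ℂ K).toLinearMap ∘ₗ
    TensorProduct.map (EuclideanSpace.proj x : Qubits ι →L[ℂ] ℂ).toLinearMap LinearMap.id

lemma slice_tmul (x : ι → Fin 2) (v : Qubits ι) (k : K) : slice K x (v ⊗ₜ[ℂ] k) = v x • k := rfl

variable [DecidableEq ι]

lemma sum_smul_ket (v : Qubits ι) : ∑ x, v x • ket x = v := by
  simpa [ket] using (EuclideanSpace.basisFun (ι → Fin 2) ℂ).sum_repr v

lemma sum_ket_tmul_slice (w : Qubits ι ⊗[ℂ] K) : ∑ x, ket x ⊗ₜ[ℂ] slice K x w = w := by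
  induction w with
  | zero => simp
  | add w w' hw hw' => simp only [map_add, TensorProduct.tmul_add, Finset.sum_add_distrib, hw, hw']
  | tmul v k =>
    simp only [slice_tmul, TensorProduct.tmul_smul, TensorProduct.smul_tmul']
    rw [← TensorProduct.sum_tmul, sum_smul_ket]

lemma slice_comp_onQubit (M : Matrix (Fin 2) (Fin 2) ℂ) (j : ι) (x : ι → Fin 2) :
    slice K x ∘ₗ onFst K (onQubit M j) =
      ∑ b : Fin 2, M (x j) b • slice K (Function.update x j b) := by
  refine TensorProduct.ext' fun v k => ?_
  simp only [LinearMap.comp_apply, TensorProduct.map_tmul, slice_tmul, onQubit_apply,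
    LinearMap.id_apply, LinearMap.sum_apply, LinearMap.smul_apply, Finset.sum_smul, mul_smul]

lemma slice_comp_Z (j : ι) (x : ι → Fin 2) :
    slice K x ∘ₗ onFst K (onQubit (pauli Letter.Z) j) = (-1 : ℂ) ^ (x j : ℕ) • slice K x := by
  rw [slice_comp_onQubit, Fin.sum_univ_two]
  have hx := Function.update_eq_self j x
  obtain h | h : x j = 0 ∨ x j = 1 := by omega
  all_goals
    rw [h] at hx
    simp [h, hx, pauli]

lemma slice_comp_X (j : ι) (x : ι → Fin 2) :
    slice K x ∘ₗ onFst K (onQubit (pauli Letter.X) j) =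
      slice K (Function.update x j (x j + 1)) := by
  rw [slice_comp_onQubit, Fin.sum_univ_two]
  obtain h | h : x j = 0 ∨ x j = 1 := by omega
  all_goals simp [h, pauli]

lemma sum_ket_tmul_ket_tmul_slice (χ : (Qubits ι ⊗[ℂ] K) ⊗[ℂ] (Qubits ι ⊗[ℂ] L)) :
    ∑ x, ∑ y, TensorProduct.tensorTensorTensorComm ℂ (Qubits ι) (Qubits ι) K L
      ((ket x ⊗ₜ[ℂ] ket y) ⊗ₜ[ℂ] TensorProduct.map (slice K x) (slice L y) χ) = χ := by
  induction χ with
  | zero => simp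
  | add w w' hw hw' => simp only [map_add, TensorProduct.tmul_add, Finset.sum_add_distrib, hw, hw']
  | tmul v w =>
    simp only [TensorProduct.map_tmul, TensorProduct.tensorTensorTensorComm_tmul,
      ← TensorProduct.tmul_sum, ← TensorProduct.sum_tmul, sum_ket_tmul_slice]

end Slices

/-! ### EPR states and the vectors stabilized by `σ_j ⊗ σ_j` -/

section EPR

lemma prod_eprAmp {n : ℕ} (x y : Fin n → Fin 2) :
    ∏ j, eprAmp (x j) (y j) = if x = y then (((Real.sqrt 2 : ℝ) : ℂ)⁻¹) ^ n else 0 := by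
  simp only [eprAmp, Finset.prod_ite_zero, funext_iff, Finset.mem_univ, true_imp_iff,
    Finset.prod_const, Finset.card_univ, Fintype.card_fin]

lemma eprShared_eq (n : ℕ) :
    eprShared n = (((Real.sqrt 2 : ℝ) : ℂ)⁻¹) ^ n • ∑ x : Fin n → Fin 2, ket x ⊗ₜ[ℂ] ket x := by
  simp [eprShared, prod_eprAmp, Finset.smul_sum]

lemma norm_eprShared (n : ℕ) : ‖eprShared n‖ = 1 := by
  have h : ‖∑ x : Fin n → Fin 2, ket x ⊗ₜ[ℂ] ket x‖ ^ 2 = 2 ^ n := by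
    rw [@norm_sq_eq_re_inner ℂ, sum_inner]
    simp_rw [inner_sum, TensorProduct.inner_tmul]
    simp only [ket, EuclideanSpace.inner_single_left, PiLp.single_apply]
    simp
    exact_mod_cast Complex.ofReal_re (2 ^ n)
  have h' : ‖∑ x : Fin n → Fin 2, ket x ⊗ₜ[ℂ] ket x‖ = Real.sqrt 2 ^ n := by
    rw [← Real.sqrt_sq (norm_nonneg _), h, Real.sqrt_eq_iff_mul_self_eq (by positivity)
      (by positivity), ← mul_pow, Real.mul_self_sqrt (by norm_num)]
  rw [eprShared_eq, norm_smul, h', norm_pow, norm_inv, Complex.norm_real, Real.norm_eq_abs,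
    abs_of_nonneg (Real.sqrt_nonneg 2), ← mul_pow, inv_mul_cancel₀ (by positivity), one_pow]

variable {A B C D : Type*} [NormedAddCommGroup A] [InnerProductSpace ℂ A]
  [NormedAddCommGroup B] [InnerProductSpace ℂ B] [NormedAddCommGroup C] [InnerProductSpace ℂ C]
  [NormedAddCommGroup D] [InnerProductSpace ℂ D]

lemma norm_tensorTensorTensorComm (x : (A ⊗[ℂ] B) ⊗[ℂ] (C ⊗[ℂ] D)) :
    ‖TensorProduct.tensorTensorTensorComm ℂ A B C D x‖ = ‖x‖ := by
  let e : (A ⊗[ℂ] B) ⊗[ℂ] (C ⊗[ℂ] D) ≃ₗᵢ[ℂ] (A ⊗[ℂ] C) ⊗[ℂ] (B ⊗[ℂ] D) :=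
    ((TensorProduct.assocIsometry ℂ A B (C ⊗[ℂ] D)).trans
      ((((TensorProduct.assocIsometry ℂ B C D).symm.trans
        ((TensorProduct.commIsometry ℂ B C).rTensor D)).trans
          (TensorProduct.assocIsometry ℂ C B D)).lTensor A)).trans
      (TensorProduct.assocIsometry ℂ A C (B ⊗[ℂ] D)).symm
  have he : e.toLinearEquiv.toLinearMap =
      (TensorProduct.tensorTensorTensorComm ℂ A B C D).toLinearMap := by
    refine TensorProduct.ext_fourfold' fun a b c d => ?_
    rfl
  have : TensorProduct.tensorTensorTensorComm ℂ A B C D x = e x := congrArg (· x) he.symm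
  rw [this]
  exact e.norm_map x

variable {n : ℕ}

lemma norm_extendedState (ψ : A ⊗[ℂ] B) : ‖extendedState n ψ‖ = ‖ψ‖ := by
  simp [extendedState, norm_tensorTensorTensorComm, norm_eprLocal]

lemma extendedState_sub (ψ φ : A ⊗[ℂ] B) :
    extendedState n (ψ - φ) = extendedState n ψ - extendedState n φ := by
  simp [extendedState, TensorProduct.sub_tmul]

lemma map_map_extendedState (S : Module.End ℂ A) (T : Module.End ℂ B)
    (S' T' : Module.End ℂ (Qubits (Fin n × Fin 2))) (ψ : A ⊗[ℂ] B) :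
    TensorProduct.map (TensorProduct.map S S') (TensorProduct.map T T') (extendedState n ψ) =
      TensorProduct.tensorTensorTensorComm ℂ A B (Qubits (Fin n × Fin 2)) (Qubits (Fin n × Fin 2))
        (TensorProduct.map S T ψ ⊗ₜ[ℂ] (S' (eprLocal n) ⊗ₜ[ℂ] T' (eprLocal n))) := by
  have := congrArg (fun f => f (ψ ⊗ₜ[ℂ] (eprLocal n ⊗ₜ[ℂ] eprLocal n)))
    (TensorProduct.tensorTensorTensorComm_comp_map (R := ℂ) S T S' T')
  exact this.symm

variable {K L : Type*} [NormedAddCommGroup K] [InnerProductSpace ℂ K]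
  [NormedAddCommGroup L] [InnerProductSpace ℂ L]

lemma norm_idealState (e : K ⊗[ℂ] L) : ‖idealState n e‖ = ‖e‖ := by
  simp [idealState, norm_tensorTensorTensorComm, norm_eprShared]

lemma idealState_sub (e f : K ⊗[ℂ] L) :
    idealState n (e - f) = idealState n e - idealState n f := by
  simp [idealState, TensorProduct.tmul_sub]

/-- The vectors fixed by all `σ_j ⊗ σ_j` are the tensor products with `n` EPR pairs. -/
lemma exists_eq_idealState {χ : (Qubits (Fin n) ⊗[ℂ] K) ⊗[ℂ] (Qubits (Fin n) ⊗[ℂ] L)}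
    (hχ : ∀ P j, TensorProduct.map (onFst K (onQubit (pauli P) j)) (onFst L (onQubit (pauli P) j)) χ =
      χ) : ∃ e : K ⊗[ℂ] L, χ = idealState n e := by
  set f : (Fin n → Fin 2) → (Fin n → Fin 2) → K ⊗[ℂ] L :=
    fun x y => TensorProduct.map (slice K x) (slice L y) χ with hf
  -- Invariance under `σᶻ ⊗ σᶻ` will kill the components with `x ≠ y`; invariance under `σˣ ⊗ σˣ`
  -- makes the diagonal ones unchanged by bit flips.
  have hZ (x y : Fin n → Fin 2) (j : Fin n) :
      f x y = ((-1 : ℂ) ^ (x j : ℕ) * (-1 : ℂ) ^ (y j : ℕ)) • f x y := by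
    conv_lhs => rw [hf]; dsimp only; rw [← hχ Letter.Z j]
    rw [← LinearMap.comp_apply, ← TensorProduct.map_comp, slice_comp_Z, slice_comp_Z,
      TensorProduct.map_smul_left, TensorProduct.map_smul_right, smul_smul, LinearMap.smul_apply]
  have hX (x : Fin n → Fin 2) (j : Fin n) :
      f x x = f (Function.update x j (x j + 1)) (Function.update x j (x j + 1)) := by
    conv_lhs => rw [hf]; dsimp only; rw [← hχ Letter.X j]
    rw [← LinearMap.comp_apply, ← TensorProduct.map_comp, slice_comp_X, slice_comp_X]
  have hne (x y : Fin n → Fin 2) (hxy : x ≠ y) : f x y = 0 := by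
    obtain ⟨j, hj⟩ := Function.ne_iff.1 hxy
    have h := hZ x y j
    have hs : (-1 : ℂ) ^ (x j : ℕ) * (-1 : ℂ) ^ (y j : ℕ) = -1 := by
      generalize x j = a at hj
      generalize y j = b at hj
      fin_cases a <;> fin_cases b <;> simp at hj ⊢
    rw [hs, neg_one_smul] at h
    have h₂ : (2 : ℂ) • f x y = 0 := by
      rw [two_smul]
      nth_rw 1 [h]
      exact neg_add_cancel _
    exact (smul_eq_zero.1 h₂).resolve_left two_ne_zero
  have hupd (x : Fin n → Fin 2) (j : Fin n) (b : Fin 2) :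
      f (Function.update x j b) (Function.update x j b) = f x x := by
    obtain h | h : b = x j ∨ b = x j + 1 := by omega
    · rw [h, Function.update_eq_self]
    · rw [h, hX x j]
  have hconst (x : Fin n → Fin 2) : f x x = f 0 0 := by
    -- The bits of `x` are reset to `0` one at a time.
    have h (s : Finset (Fin n)) : f (s.piecewise 0 x) (s.piecewise 0 x) = f x x := by
      induction s using Finset.induction_on with
      | empty => simp
      | insert j s _ ih => rw [Finset.piecewise_insert, hupd, ih]
    rw [← h Finset.univ]
    simp
  -- The factor cancels the normalization of the `n` EPR pairs.
  refine ⟨((Real.sqrt 2 : ℝ) : ℂ) ^ n • f 0 0, ?_⟩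
  have hsqrt : ((Real.sqrt 2 : ℝ) : ℂ) ≠ 0 := by simp
  rw [idealState, eprShared_eq, TensorProduct.tmul_smul, ← TensorProduct.smul_tmul', smul_smul,
    ← mul_pow, mul_inv_cancel₀ hsqrt, one_pow, one_smul, TensorProduct.sum_tmul, map_sum,
    ← sum_ket_tmul_ket_tmul_slice χ]
  refine Finset.sum_congr rfl fun x _ => ?_
  rw [Finset.sum_eq_single x, ← hconst x]
  · intro y _ hy
    change TensorProduct.tensorTensorTensorComm ℂ _ _ _ _ (_ ⊗ₜ[ℂ] f x y) = 0
    rw [hne x y hy.symm, TensorProduct.tmul_zero, map_zero]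
  · simp

end EPR

/-! ### A nearby unit vector in the stabilized space -/

section Close

variable {E F : Type*} [NormedAddCommGroup E] [InnerProductSpace ℂ E]
  [NormedAddCommGroup F] [InnerProductSpace ℂ F] {n : ℕ}

lemma isReflection_map {S : Module.End ℂ E} {T : Module.End ℂ F}
    (hS : IsReflection S) (hT : IsReflection T) : IsReflection (TensorProduct.map S T) := by
  refine ⟨isSymmetric_map hS.1 hT.1, ?_⟩
  rw [← TensorProduct.map_mul, hS.2, hT.2]
  exact TensorProduct.map_id

/-- The operators `σ_j ⊗ σ_j` commute with each other. -/
lemma commute_map_map {p : Letter → Fin n → Module.End ℂ E} {q : Letter → Fin n → Module.End ℂ F}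
    (hp : IsQubitFamily p) (hq : IsQubitFamily q)
    (hpp : ∀ P Q i j, i ≠ j → Commute (p P i) (p Q j))
    (hqq : ∀ P Q i j, i ≠ j → Commute (q P i) (q Q j)) (P Q : Letter) (i j : Fin n) :
    Commute (TensorProduct.map (p P i) (q P i)) (TensorProduct.map (p Q j) (q Q j)) := by
  have hneg (S : Module.End ℂ E) (T : Module.End ℂ F) :
      TensorProduct.map (-S) (-T) = TensorProduct.map S T := by
    rw [← neg_one_smul ℂ S, ← neg_one_smul ℂ T, TensorProduct.map_smul_left,
      TensorProduct.map_smul_right, smul_smul]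
    norm_num
  change _ * _ = _ * _
  rw [← TensorProduct.map_mul, ← TensorProduct.map_mul]
  by_cases hij : i = j
  · subst hij
    cases P <;> cases Q
    · rfl
    · rw [hp.anticomm, hq.anticomm, hneg]
    · rw [hp.anticomm, hq.anticomm, hneg]
    · rfl
  · rw [(hpp P Q i j hij).eq, (hqq P Q i j hij).eq]

variable {M V : Type*} [NormedAddCommGroup M] [InnerProductSpace ℂ M]
  [NormedAddCommGroup V] [InnerProductSpace ℂ V]

/-- If all vectors fixed by `2n` commuting reflections lie in the range of an isometry, then a unit
vector approximately fixed by them is close to the image of a unit vector. -/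
lemma exists_unit_close [Nontrivial V] {G : Letter → Fin n → Module.End ℂ M} {J : V → M}
    (hJ : ∀ e, ‖J e‖ = ‖e‖) (hJ_sub : ∀ e f, J (e - f) = J e - J f) (hG : ∀ P j, IsReflection (G P j))
    (hGG : ∀ P Q i j, Commute (G P i) (G Q j))
    (hfix : ∀ χ, (∀ P j, G P j χ = χ) → ∃ e, χ = J e)
    {φ : M} {δ : ℝ} (hφ : ‖φ‖ = 1) (hδ : ∀ P j, ‖G P j φ - φ‖ ≤ δ) :
    ∃ e : V, ‖e‖ = 1 ∧ ‖φ - J e‖ ≤ 2 * Real.sqrt (2 * n * (δ / 2) ^ 2) := by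
  obtain ⟨χ, hχ, hle⟩ := exists_fixed_of_approx
    (l := (List.finRange n).map (G Letter.X) ++ (List.finRange n).map (G Letter.Z))
    (φ := φ) (δ := δ)
    (by
      intro a ha
      simp only [List.mem_append, List.mem_map] at ha
      obtain ⟨j, -, rfl⟩ | ⟨j, -, rfl⟩ := ha <;> exact hG _ _)
    (by
      intro a ha b hb
      simp only [List.mem_append, List.mem_map] at ha hb
      obtain ⟨j, -, rfl⟩ | ⟨j, -, rfl⟩ := ha <;> obtain ⟨k, -, rfl⟩ | ⟨k, -, rfl⟩ := hb <;>
        exact hGG _ _ _ _)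
    (by
      intro a ha
      simp only [List.mem_append, List.mem_map] at ha
      obtain ⟨j, -, rfl⟩ | ⟨j, -, rfl⟩ := ha <;> exact hδ _ _)
  obtain ⟨e, rfl⟩ := hfix χ fun P j => hχ _ (by
    cases P
    · exact List.mem_append_left _ (List.mem_map_of_mem (List.mem_finRange j))
    · exact List.mem_append_right _ (List.mem_map_of_mem (List.mem_finRange j)))
  have hη : ‖φ - J e‖ ≤ Real.sqrt (2 * n * (δ / 2) ^ 2) := by
    refine Real.le_sqrt_of_sq_le (hle.trans_eq ?_)
    simp only [List.length_append, List.length_map, List.length_finRange]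
    push_cast
    ring
  generalize Real.sqrt (2 * n * (δ / 2) ^ 2) = η at hη
  -- If the projection vanishes then `1 ≤ η`, and any unit vector is within `2 ≤ 2η`. Otherwise
  -- normalizing moves the vector by at most another `η`.
  rcases eq_or_ne e 0 with rfl | he
  · have hJ0 : J 0 = 0 := norm_eq_zero.1 ((hJ 0).trans norm_zero)
    rw [hJ0, sub_zero, hφ] at hη
    obtain ⟨e, he⟩ := exists_norm_eq (E := V) zero_le_one
    refine ⟨e, he, (norm_sub_le _ _).trans ?_⟩
    rw [hJ, hφ, he]
    linarith
  · have he' : ‖e‖ ≠ 0 := norm_ne_zero_iff.2 he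
    refine ⟨((‖e‖⁻¹ : ℝ) : ℂ) • e, ?_, ?_⟩
    · rw [norm_smul, Complex.norm_real, norm_inv, norm_norm, inv_mul_cancel₀ he']
    · have h₁ : ‖J e - J (((‖e‖⁻¹ : ℝ) : ℂ) • e)‖ ≤ η := by
        have e₁ : e - ((‖e‖⁻¹ : ℝ) : ℂ) • e = ((1 - ‖e‖⁻¹ : ℝ) : ℂ) • e := by
          push_cast
          module
        have h₂ := abs_norm_sub_norm_le φ (J e)
        rw [hφ, hJ, abs_sub_comm] at h₂
        rw [← hJ_sub, hJ, e₁, norm_smul, Complex.norm_real, Real.norm_eq_abs,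
          ← abs_of_nonneg (norm_nonneg e), ← abs_mul, abs_norm, sub_mul, one_mul,
          inv_mul_cancel₀ he']
        exact h₂.trans hη
      have := norm_sub_le_add hη h₁
      linarith

end Close
-- The extracted qubits approximate the given ones
section Extraction

variable {E F : Type*} [NormedAddCommGroup E] [InnerProductSpace ℂ E]
  [NormedAddCommGroup F] [InnerProductSpace ℂ F] {n : ℕ}

/-- Qubits `p`, with ancillary qubits `q` and `r` independent of them. -/
structure IsExtension (p q r : Letter → Fin n → Module.End ℂ E) : Prop where
  left : IsQubitFamily p
  mid : IsQubitFamily q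
  right : IsQubitFamily r
  left_mid : MutuallyCommute p q
  left_right : MutuallyCommute p r
  mid_right : MutuallyCommute q r
  indep : ∀ P Q i j, i ≠ j → Commute (q P i) (q Q j)

/-- The independent qubits obtained from `p` by swapping them out into `q`. -/
def extracted (p q : Letter → Fin n → Module.End ℂ E) (P : Letter) (j : Fin n) : Module.End ℂ E :=
  swapOutInv p q * q P j * swapOut p q

lemma swapOutEquiv_extracted {p q : Letter → Fin n → Module.End ℂ E} (hp : IsQubitFamily p)
    (hq : IsQubitFamily q) (hpq : MutuallyCommute p q) (P : Letter) (j : Fin n) (v : E) :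
    swapOutEquiv hp hq hpq (extracted p q P j v) = q P j (swapOutEquiv hp hq hpq v) :=
  congrArg (· (q P j (swapOut p q v))) (swapOut_mul_swapOutInv hp hq hpq)

lemma isReflection_extracted {p q : Letter → Fin n → Module.End ℂ E} (hp : IsQubitFamily p)
    (hq : IsQubitFamily q) (hpq : MutuallyCommute p q) (P : Letter) (j : Fin n) :
    IsReflection (extracted p q P j) := by
  refine ⟨fun v w => ?_, ?_⟩
  · rw [← (swapOutEquiv hp hq hpq).inner_map_map, swapOutEquiv_extracted, (hq.reflection P j).1,
      ← swapOutEquiv_extracted, (swapOutEquiv hp hq hpq).inner_map_map]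
  · refine LinearMap.ext fun v => (swapOutEquiv hp hq hpq).injective ?_
    rw [Module.End.mul_apply, swapOutEquiv_extracted, swapOutEquiv_extracted,
      (hq.reflection P j).apply_apply, Module.End.one_apply]

variable {p q r : Letter → Fin n → Module.End ℂ E} {s t u : Letter → Fin n → Module.End ℂ F}
  {ψ : E ⊗[ℂ] F} {ε : ℝ}

/-- The single-space estimate is applied on `E ⊗ F`, with the other party's qubits as `s`; the swaps
are carried there by the algebra homomorphism `onFstHom`. -/
lemma norm_onFst_extracted_sub_le (hε : 0 ≤ ε) (hA : IsExtension p q r) (hs : IsQubitFamily s)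
    (hqr : ∀ P j, onFst F (q P j) ψ = onFst F (r P j) ψ)
    (hps : ∀ P j, ‖onFst F (p P j) ψ - onSnd E (s P j) ψ‖ ≤ ε)
    (hpp : ∀ P Q i j, i ≠ j → ‖onFst F (p P i * p Q j - p Q j * p P i) ψ‖ ≤ ε)
    (P : Letter) (j : Fin n) :
    ‖onFst F (extracted p q P j) ψ - onFst F (p P j) ψ‖ ≤ n * (9 * ε) := by
  have := norm_swapOut_conj_sub_le hε hA.left.onFst hA.mid.onFst hA.right.onFst hs.onSnd
    hA.left_mid.onFst hA.left_right.onFst (mutuallyCommute_onFst_onSnd p s) hA.mid_right.onFst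
    (mutuallyCommute_onFst_onSnd q s) (mutuallyCommute_onFst_onSnd r s).symm
    (fun P Q i j h => Commute.onFst (hA.indep P Q i j h)) hqr hps
    (fun P Q i j h => by
      have := hpp P Q i j h
      rwa [← onFstHom_apply, map_sub, map_mul, map_mul] at this) P j
  rw [← onFstHom_apply (extracted p q P j), extracted, map_mul, map_mul, map_swapOut,
    map_swapOutInv]
  exact this

lemma norm_onSnd_extracted_sub_le (hε : 0 ≤ ε) (hB : IsExtension s t u) (hp : IsQubitFamily p)
    (htu : ∀ P j, onSnd E (t P j) ψ = onSnd E (u P j) ψ)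
    (hps : ∀ P j, ‖onFst F (p P j) ψ - onSnd E (s P j) ψ‖ ≤ ε)
    (hss : ∀ P Q i j, i ≠ j → ‖onSnd E (s P i * s Q j - s Q j * s P i) ψ‖ ≤ ε)
    (P : Letter) (j : Fin n) :
    ‖onSnd E (extracted s t P j) ψ - onSnd E (s P j) ψ‖ ≤ n * (9 * ε) := by
  have := norm_swapOut_conj_sub_le hε hB.left.onSnd hB.mid.onSnd hB.right.onSnd hp.onFst
    hB.left_mid.onSnd hB.left_right.onSnd (mutuallyCommute_onFst_onSnd p s).symm hB.mid_right.onSnd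
    (mutuallyCommute_onFst_onSnd p t).symm (mutuallyCommute_onFst_onSnd p u)
    (fun P Q i j h => Commute.onSnd (hB.indep P Q i j h)) htu
    (fun P j => (norm_sub_rev _ _).trans_le (hps P j))
    (fun P Q i j h => by
      have := hss P Q i j h
      rwa [← onSndHom_apply, map_sub, map_mul, map_mul] at this) P j
  rw [← onSndHom_apply (extracted s t P j), extracted, map_mul, map_mul, map_swapOut,
    map_swapOutInv]
  exact this

lemma map_eq_onFst_onSnd (S : Module.End ℂ E) (T : Module.End ℂ F) (v : E ⊗[ℂ] F) :
    TensorProduct.map S T v = onFst F S (onSnd E T v) := by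
  rw [← LinearMap.comp_apply, ← TensorProduct.map_comp]
  rfl

/-- On `ψ`, `S'T' ≈ S'T = TS' ≈ TS ≈ TT = 1`, with errors `β`, `α`, `γ` in turn. -/
lemma norm_map_sub_le {S S' : Module.End ℂ E} {T T' : Module.End ℂ F} {α β γ : ℝ}
    (hS' : IsReflection S') (hT : IsReflection T)
    (hA : ‖onFst F S' ψ - onFst F S ψ‖ ≤ α) (hB : ‖onSnd E T' ψ - onSnd E T ψ‖ ≤ β)
    (hST : ‖onFst F S ψ - onSnd E T ψ‖ ≤ γ) :
    ‖TensorProduct.map S' T' ψ - ψ‖ ≤ β + α + γ := by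
  have hc (v : E ⊗[ℂ] F) : onFst F S' (onSnd E T v) = onSnd E T (onFst F S' v) :=
    congrArg (· v) (commute_onFst_onSnd S' T).eq
  rw [map_eq_onFst_onSnd]
  refine norm_sub_le_add (b := onSnd E T (onFst F S ψ)) (norm_sub_le_add
    (b := onFst F S' (onSnd E T ψ)) ?_ ?_) ?_
  · rwa [← map_sub, hS'.onFst.norm_apply]
  · rwa [hc, ← map_sub, hT.onSnd.norm_apply]
  · have : ψ = onSnd E T (onSnd E T ψ) := (hT.onSnd.apply_apply ψ).symm
    conv_lhs => rw [this, ← this]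
    nth_rw 2 [this]
    rwa [← map_sub, hT.onSnd.norm_apply]

end Extraction

/-! ### Transport along the local unitaries -/

section Transport

variable {E F G H : Type*} [NormedAddCommGroup E] [InnerProductSpace ℂ E]
  [NormedAddCommGroup F] [InnerProductSpace ℂ F] [NormedAddCommGroup G] [InnerProductSpace ℂ G]
  [NormedAddCommGroup H] [InnerProductSpace ℂ H] {U : E ≃ₗᵢ[ℂ] G} {V : F ≃ₗᵢ[ℂ] H}

lemma map_congrIsometry {S : Module.End ℂ E} {T : Module.End ℂ F} {S' : Module.End ℂ G}
    {T' : Module.End ℂ H} (hS : ∀ v, S' (U v) = U (S v)) (hT : ∀ v, T' (V v) = V (T v))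
    (v : E ⊗[ℂ] F) : TensorProduct.map S' T' (TensorProduct.congrIsometry U V v) =
      TensorProduct.congrIsometry U V (TensorProduct.map S T v) := by
  induction v with
  | zero => simp
  | add v w hv hw => simp only [map_add, hv, hw]
  | tmul a b => simp [hS, hT]

lemma norm_map_congrIsometry_sub {S : Module.End ℂ E} {T : Module.End ℂ F} {S' : Module.End ℂ G}
    {T' : Module.End ℂ H} (hS : ∀ v, S' (U v) = U (S v)) (hT : ∀ v, T' (V v) = V (T v))
    (ψ : E ⊗[ℂ] F) : ‖TensorProduct.map S' T' (TensorProduct.congrIsometry U V ψ) -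
      TensorProduct.congrIsometry U V ψ‖ = ‖TensorProduct.map S T ψ - ψ‖ := by
  rw [map_congrIsometry hS hT, ← map_sub, LinearIsometryEquiv.norm_map]

/-- Serves to pass from the actual state `w`, where `a` and `b` are known to be close, to the ideal
state `v`; each reflection is an isometry and contributes one `‖w - v‖`. -/
lemma norm_sub_apply_le {a b : Module.End ℂ E} (ha : IsReflection a) (hb : IsReflection b)
    (v w : E) : ‖(a - b) v‖ ≤ ‖b w - a w‖ + 2 * ‖w - v‖ := by
  have e : (a - b) v = (a w - b w) + (b (w - v) - a (w - v)) := by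
    simp only [LinearMap.sub_apply, map_sub]
    abel
  have h₁ := norm_add_le (a w - b w) (b (w - v) - a (w - v))
  have h₂ := norm_sub_le (b (w - v)) (a (w - v))
  rw [ha.norm_apply, hb.norm_apply] at h₂
  rw [norm_sub_rev (a w)] at h₁
  rw [e]
  linarith

lemma norm_onFst_defect_le {a b : Module.End ℂ E} {D : Module.End ℂ G} (ha : IsReflection a)
    (hb : IsReflection b) (hD : ∀ v, D (U v) = U ((a - b) v)) (ψ : E ⊗[ℂ] F) (χ : G ⊗[ℂ] H) :
    ‖onFst H D χ‖ ≤ ‖onFst F b ψ - onFst F a ψ‖ +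
      2 * ‖TensorProduct.congrIsometry U V ψ - χ‖ := by
  obtain ⟨v, rfl⟩ := (TensorProduct.congrIsometry U V).surjective χ
  rw [onFst, map_congrIsometry (T := LinearMap.id) hD fun _ => rfl, ← map_sub,
    LinearIsometryEquiv.norm_map, LinearIsometryEquiv.norm_map]
  have := norm_sub_apply_le (ha.onFst (F := F)) hb.onFst v ψ
  rwa [← onFstHom_apply, ← onFstHom_apply, ← map_sub] at this

lemma norm_onSnd_defect_le {a b : Module.End ℂ F} {D : Module.End ℂ H} (ha : IsReflection a)
    (hb : IsReflection b) (hD : ∀ v, D (V v) = V ((a - b) v)) (ψ : E ⊗[ℂ] F) (χ : G ⊗[ℂ] H) :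
    ‖onSnd G D χ‖ ≤ ‖onSnd E b ψ - onSnd E a ψ‖ +
      2 * ‖TensorProduct.congrIsometry U V ψ - χ‖ := by
  obtain ⟨v, rfl⟩ := (TensorProduct.congrIsometry U V).surjective χ
  rw [onSnd, map_congrIsometry (S := LinearMap.id) (fun _ => rfl) hD, ← map_sub,
    LinearIsometryEquiv.norm_map, LinearIsometryEquiv.norm_map]
  have := norm_sub_apply_le (ha.onSnd (E := E)) hb.onSnd v ψ
  rwa [← onSndHom_apply, ← onSndHom_apply, ← map_sub] at this

end Transport

/-! ### The ancillas and the extraction unitary -/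

section Ancilla

variable {H : Type*} [NormedAddCommGroup H] [InnerProductSpace ℂ H] {n : ℕ}

/-- Qubits on `H`, as operators on `H` together with the ancillas. -/
abbrev withAncilla (p : Letter → Fin n → Module.End ℂ H) (P : Letter) (j : Fin n) :
    Module.End ℂ (H ⊗[ℂ] Qubits (Fin n × Fin 2)) := onFst (Qubits (Fin n × Fin 2)) (p P j)

/-- The ancillary qubit `(j, k)`. -/
abbrev ancilla (H : Type*) [NormedAddCommGroup H] [InnerProductSpace ℂ H] (n : ℕ) (k : Fin 2)
    (P : Letter) (j : Fin n) : Module.End ℂ (H ⊗[ℂ] Qubits (Fin n × Fin 2)) :=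
  onSnd H (onQubit (pauli P) (j, k))

lemma isExtension_ancilla {p : Letter → Fin n → Module.End ℂ H} (hp : IsQubitFamily p) :
    IsExtension (withAncilla p) (ancilla H n 0) (ancilla H n 1) where
  left := hp.onFst
  mid := (isQubitFamily_onQubit fun j => (j, 0)).onSnd
  right := (isQubitFamily_onQubit fun j => (j, 1)).onSnd
  left_mid := mutuallyCommute_onFst_onSnd _ _
  left_right := mutuallyCommute_onFst_onSnd _ _
  mid_right := fun P i Q j => Commute.onSnd (commute_onQubit _ _ (by simp))
  indep := fun P Q i j h => Commute.onSnd (commute_onQubit _ _ (by simpa using h))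

variable [FiniteDimensional ℂ H]

/-- The unitary extracting `n` qubits. -/
def extractionUnitary {p : Letter → Fin n → Module.End ℂ H} (hp : IsQubitFamily p) :
    (H ⊗[ℂ] Qubits (Fin n × Fin 2)) ≃ₗᵢ[ℂ]
      (Qubits (Fin n) ⊗[ℂ] EuclideanSpace ℂ (Fin (residualDim H n))) :=
  (swapOutEquiv (isExtension_ancilla hp).left (isExtension_ancilla hp).mid
    (isExtension_ancilla hp).left_mid).trans (extractQubits H n)

lemma onQubit_extractionUnitary {p : Letter → Fin n → Module.End ℂ H} (hp : IsQubitFamily p)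
    (P : Letter) (j : Fin n) (v : H ⊗[ℂ] Qubits (Fin n × Fin 2)) :
    onFst (EuclideanSpace ℂ (Fin (residualDim H n))) (onQubit (pauli P) j)
      (extractionUnitary hp v) =
      extractionUnitary hp (extracted (withAncilla p) (ancilla H n 0) P j v) :=
  (extractQubits_onQubit (pauli P) j _).symm.trans
    (congrArg (extractQubits H n) (swapOutEquiv_extracted (isExtension_ancilla hp).left
      (isExtension_ancilla hp).mid (isExtension_ancilla hp).left_mid P j v).symm)

lemma pauliDefect_extractionUnitary {p : Letter → Fin n → Module.End ℂ H} (hp : IsQubitFamily p)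
    (P : Letter) (j : Fin n) (v : H ⊗[ℂ] Qubits (Fin n × Fin 2)) :
    pauliDefect (extractionUnitary hp) (p P j) (pauli P) j (extractionUnitary hp v) =
      extractionUnitary hp
        ((withAncilla p P j - extracted (withAncilla p) (ancilla H n 0) P j) v) := by
  rw [LinearMap.sub_apply, map_sub, ← onQubit_extractionUnitary]
  change extractionUnitary hp (onFst _ (p P j) ((extractionUnitary hp).symm
    (extractionUnitary hp v))) - _ = _
  rw [LinearIsometryEquiv.symm_apply_apply]

end Ancilla

end
end EPRTest

namespace EPRTest

/-! ### Estimates for the given state with its ancillas -/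

section Bounds

variable {HA HB : Type*} [NormedAddCommGroup HA] [InnerProductSpace ℂ HA]
  [NormedAddCommGroup HB] [InnerProductSpace ℂ HB] {n : ℕ} {ε : ℝ} {ψ : HA ⊗[ℂ] HB}
  {PA : Letter → Fin n → Module.End ℂ HA} {PB : Letter → Fin n → Module.End ℂ HB}

lemma OverlappingQubits.isQubitFamily_A (h : OverlappingQubits n ε ψ PA PB) :
    IsQubitFamily PA := ⟨h.reflection_A, fun j => eq_neg_of_add_eq_zero_left (h.anticomm_A j)⟩

lemma OverlappingQubits.isQubitFamily_B (h : OverlappingQubits n ε ψ PA PB) :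
    IsQubitFamily PB := ⟨h.reflection_B, fun j => eq_neg_of_add_eq_zero_left (h.anticomm_B j)⟩

lemma onFst_onFst_extendedState (S : Module.End ℂ HA) (ψ : HA ⊗[ℂ] HB) :
    onFst (HB ⊗[ℂ] Qubits (Fin n × Fin 2)) (onFst (Qubits (Fin n × Fin 2)) S)
      (extendedState n ψ) = extendedState n (onFst HB S ψ) := by
  have := map_map_extendedState (n := n) S LinearMap.id LinearMap.id LinearMap.id ψ
  rwa [TensorProduct.map_id] at this

lemma onSnd_onFst_extendedState (T : Module.End ℂ HB) (ψ : HA ⊗[ℂ] HB) :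
    onSnd (HA ⊗[ℂ] Qubits (Fin n × Fin 2)) (onFst (Qubits (Fin n × Fin 2)) T)
      (extendedState n ψ) = extendedState n (onSnd HA T ψ) := by
  have := map_map_extendedState (n := n) LinearMap.id T LinearMap.id LinearMap.id ψ
  rwa [TensorProduct.map_id] at this

lemma onFst_ancilla_extendedState (P : Letter) (j : Fin n) (ψ : HA ⊗[ℂ] HB) :
    onFst (HB ⊗[ℂ] Qubits (Fin n × Fin 2)) (ancilla HA n 0 P j) (extendedState n ψ) =
      onFst (HB ⊗[ℂ] Qubits (Fin n × Fin 2)) (ancilla HA n 1 P j) (extendedState n ψ) := by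
  have h (k : Fin 2) := map_map_extendedState (n := n) LinearMap.id LinearMap.id
    (onQubit (pauli P) (j, k)) LinearMap.id ψ
  simp only [TensorProduct.map_id] at h
  have h₀ := h 0
  rw [onQubit_eprLocal] at h₀
  exact h₀.trans (h 1).symm

lemma onSnd_ancilla_extendedState (P : Letter) (j : Fin n) (ψ : HA ⊗[ℂ] HB) :
    onSnd (HA ⊗[ℂ] Qubits (Fin n × Fin 2)) (ancilla HB n 0 P j) (extendedState n ψ) =
      onSnd (HA ⊗[ℂ] Qubits (Fin n × Fin 2)) (ancilla HB n 1 P j) (extendedState n ψ) := by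
  have h (k : Fin 2) := map_map_extendedState (n := n) LinearMap.id LinearMap.id
    LinearMap.id (onQubit (pauli P) (j, k)) ψ
  simp only [TensorProduct.map_id] at h
  have h₀ := h 0
  rw [onQubit_eprLocal] at h₀
  exact h₀.trans (h 1).symm

lemma OverlappingQubits.norm_onFst_sub_onSnd_le (h : OverlappingQubits n ε ψ PA PB) (P : Letter)
    (j : Fin n) : ‖onFst HB (PA P j) ψ - onSnd HA (PB P j) ψ‖ ≤ ε := by
  have hB := (h.reflection_B P j).onSnd (E := HA)
  have hs := h.stabilized P j
  have hc : onFst HB (PA P j) (onSnd HA (PB P j) ψ) = onSnd HA (PB P j) (onFst HB (PA P j) ψ) :=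
    congrArg (· ψ) (commute_onFst_onSnd _ _).eq
  rw [map_eq_onFst_onSnd, hc, ← hB.norm_apply, map_sub, hB.apply_apply] at hs
  exact hs

lemma OverlappingQubits.norm_withAncilla_sub_le (h : OverlappingQubits n ε ψ PA PB) (P : Letter)
    (j : Fin n) : ‖onFst (HB ⊗[ℂ] Qubits (Fin n × Fin 2)) (withAncilla PA P j) (extendedState n ψ) -
      onSnd (HA ⊗[ℂ] Qubits (Fin n × Fin 2)) (withAncilla PB P j) (extendedState n ψ)‖ ≤ ε := by
  rw [onFst_onFst_extendedState, onSnd_onFst_extendedState, ← extendedState_sub,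
    norm_extendedState]
  exact h.norm_onFst_sub_onSnd_le P j

lemma OverlappingQubits.norm_onFst_extracted_sub_le (hε : 0 ≤ ε)
    (h : OverlappingQubits n ε ψ PA PB) (P : Letter) (j : Fin n) :
    ‖onFst (HB ⊗[ℂ] Qubits (Fin n × Fin 2)) (extracted (withAncilla PA) (ancilla HA n 0) P j)
      (extendedState n ψ) - onFst (HB ⊗[ℂ] Qubits (Fin n × Fin 2)) (withAncilla PA P j)
      (extendedState n ψ)‖ ≤ n * (9 * ε) := by
  refine EPRTest.norm_onFst_extracted_sub_le hε (isExtension_ancilla h.isQubitFamily_A)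
    (isExtension_ancilla h.isQubitFamily_B).left (fun P j => onFst_ancilla_extendedState P j ψ)
    h.norm_withAncilla_sub_le (fun P Q i j hij => ?_) P j
  have e : withAncilla PA P i * withAncilla PA Q j - withAncilla PA Q j * withAncilla PA P i =
      onFst (Qubits (Fin n × Fin 2)) (PA P i * PA Q j - PA Q j * PA P i) := by
    simp only [withAncilla, ← onFstHom_apply, map_sub, map_mul]
  rw [e]
  exact (congrArg norm (onFst_onFst_extendedState _ ψ)).trans (norm_extendedState _) |>.trans_le
    (h.comm_A P Q i j hij)

lemma OverlappingQubits.norm_onSnd_extracted_sub_le (hε : 0 ≤ ε)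
    (h : OverlappingQubits n ε ψ PA PB) (P : Letter) (j : Fin n) :
    ‖onSnd (HA ⊗[ℂ] Qubits (Fin n × Fin 2)) (extracted (withAncilla PB) (ancilla HB n 0) P j)
      (extendedState n ψ) - onSnd (HA ⊗[ℂ] Qubits (Fin n × Fin 2)) (withAncilla PB P j)
      (extendedState n ψ)‖ ≤ n * (9 * ε) := by
  refine EPRTest.norm_onSnd_extracted_sub_le hε (isExtension_ancilla h.isQubitFamily_B)
    (isExtension_ancilla h.isQubitFamily_A).left (fun P j => onSnd_ancilla_extendedState P j ψ)
    h.norm_withAncilla_sub_le (fun P Q i j hij => ?_) P j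
  have e : withAncilla PB P i * withAncilla PB Q j - withAncilla PB Q j * withAncilla PB P i =
      onFst (Qubits (Fin n × Fin 2)) (PB P i * PB Q j - PB Q j * PB P i) := by
    simp only [withAncilla, ← onFstHom_apply, map_sub, map_mul]
  rw [e]
  exact (congrArg norm (onSnd_onFst_extendedState _ ψ)).trans (norm_extendedState _) |>.trans_le
    (h.comm_B P Q i j hij)

lemma OverlappingQubits.nonneg (h : OverlappingQubits n ε ψ PA PB) (j : Fin n) : 0 ≤ ε :=
  (norm_nonneg _).trans (h.stabilized Letter.X j)

/-- Guarantees that a unit vector `extra` exists even when the projected vector is zero. -/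
lemma nontrivial_of_ne_zero {K L : Type*} [NormedAddCommGroup K] [InnerProductSpace ℂ K]
    [NormedAddCommGroup L] [InnerProductSpace ℂ L]
    {φ : (Qubits (Fin n) ⊗[ℂ] K) ⊗[ℂ] (Qubits (Fin n) ⊗[ℂ] L)} (hφ : φ ≠ 0) :
    Nontrivial (K ⊗[ℂ] L) := by
  by_contra hK
  rw [not_nontrivial_iff_subsingleton] at hK
  refine hφ ((sum_ket_tmul_ket_tmul_slice φ).symm.trans ?_)
  refine Finset.sum_eq_zero fun x _ => Finset.sum_eq_zero fun y _ => ?_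
  rw [Subsingleton.elim (TensorProduct.map (slice K x) (slice L y) φ) 0, TensorProduct.tmul_zero,
    map_zero]

lemma exists_idealState_close {K L : Type*} [NormedAddCommGroup K] [InnerProductSpace ℂ K]
    [NormedAddCommGroup L] [InnerProductSpace ℂ L]
    {φ : (Qubits (Fin n) ⊗[ℂ] K) ⊗[ℂ] (Qubits (Fin n) ⊗[ℂ] L)} {δ : ℝ} (hφ : ‖φ‖ = 1)
    (hδ : ∀ P j, ‖TensorProduct.map (onFst K (onQubit (pauli P) j))
      (onFst L (onQubit (pauli P) j)) φ - φ‖ ≤ δ) :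
    ∃ e : K ⊗[ℂ] L, ‖e‖ = 1 ∧ ‖φ - idealState n e‖ ≤ 2 * Real.sqrt (2 * n * (δ / 2) ^ 2) := by
  have hφ0 : φ ≠ 0 := by
    rintro rfl
    exact zero_ne_one ((norm_zero (E := (Qubits (Fin n) ⊗[ℂ] K) ⊗[ℂ]
      (Qubits (Fin n) ⊗[ℂ] L))).symm.trans hφ)
  have := nontrivial_of_ne_zero hφ0
  have hq := isQubitFamily_onQubit (id : Fin n → Fin n)
  have hc (P Q : Letter) (i j : Fin n) (h : i ≠ j) :
    Commute (onQubit (pauli P) i) (onQubit (pauli Q) j) := commute_onQubit _ _ h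
  have h₁ : ∀ P j, IsReflection (E := (Qubits (Fin n) ⊗[ℂ] K) ⊗[ℂ] (Qubits (Fin n) ⊗[ℂ] L))
      (TensorProduct.map (onFst K (onQubit (pauli P) j)) (onFst L (onQubit (pauli P) j))) :=
    fun P j => isReflection_map (hq.onFst.reflection P j) (hq.onFst.reflection P j)
  have h₂ := commute_map_map (hq.onFst (F := K)) (hq.onFst (F := L))
    (fun P Q i j h => Commute.onFst (hc P Q i j h))
    (fun P Q i j h => Commute.onFst (hc P Q i j h))
  exact exists_unit_close (M := (Qubits (Fin n) ⊗[ℂ] K) ⊗[ℂ] (Qubits (Fin n) ⊗[ℂ] L))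
    (V := K ⊗[ℂ] L) (J := idealState n) norm_idealState idealState_sub h₁ h₂
    (fun χ hχ => exists_eq_idealState hχ) hφ hδ

end Bounds

/-- The left side is `19√2 · n^{3/2} ε`, and `19√2 < 28`. -/
lemma two_mul_sqrt_le {n : ℕ} {ε : ℝ} (hε : 0 < n → 0 ≤ ε) :
    2 * Real.sqrt (2 * n * ((19 * n * ε) / 2) ^ 2) ≤ 28 * (n : ℝ) ^ (3 / 2 : ℝ) * ε := by
  rcases Nat.eq_zero_or_pos n with rfl | hn
  · norm_num
  · have hn' : (0 : ℝ) < n := by exact_mod_cast hn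
    have hpow : ((n : ℝ) ^ (3 / 2 : ℝ)) ^ 2 = (n : ℝ) ^ 3 := by
      rw [← Real.rpow_natCast, ← Real.rpow_mul hn'.le, ← Real.rpow_natCast]
      norm_num
    have h : Real.sqrt (2 * n * ((19 * n * ε) / 2) ^ 2) ≤ 14 * (n : ℝ) ^ (3 / 2 : ℝ) * ε := by
      refine Real.sqrt_le_iff.2 ⟨by have := hε hn; positivity, ?_⟩
      rw [mul_pow, mul_pow, hpow]
      have : 0 ≤ (n : ℝ) ^ 3 * ε ^ 2 := by positivity
      nlinarith
    linarith

lemma natCast_le_rpow {n : ℕ} : (n : ℝ) ≤ (n : ℝ) ^ (3 / 2 : ℝ) := by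
  rcases Nat.eq_zero_or_pos n with rfl | hn
  · norm_num
  · exact Real.self_le_rpow_of_one_le (by exact_mod_cast hn) (by norm_num)

end EPRTest

/-! ### The main theorem -/

open EPRTest in
theorem corollary2 :
    ∃ C : ℝ, 0 < C ∧
      ∀ (n : ℕ) (ε : ℝ)
        (HA : Type*) [NormedAddCommGroup HA] [InnerProductSpace ℂ HA] [FiniteDimensional ℂ HA]
        (HB : Type*) [NormedAddCommGroup HB] [InnerProductSpace ℂ HB] [FiniteDimensional ℂ HB]
        (ψ : HA ⊗[ℂ] HB)
        (PA : Letter → Fin n → Module.End ℂ HA) (PB : Letter → Fin n → Module.End ℂ HB),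
        OverlappingQubits n ε ψ PA PB →
        ∃ (mA mB : ℕ)
          (UA : (HA ⊗[ℂ] Qubits (Fin n × Fin 2)) ≃ₗᵢ[ℂ]
            (Qubits (Fin n) ⊗[ℂ] EuclideanSpace ℂ (Fin mA)))
          (UB : (HB ⊗[ℂ] Qubits (Fin n × Fin 2)) ≃ₗᵢ[ℂ]
            (Qubits (Fin n) ⊗[ℂ] EuclideanSpace ℂ (Fin mB)))
          (extra : EuclideanSpace ℂ (Fin mA) ⊗[ℂ] EuclideanSpace ℂ (Fin mB)),
          ‖extra‖ = 1 ∧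
          ‖TensorProduct.congrIsometry UA UB (extendedState n ψ) - idealState n extra‖
            ≤ C * (n : ℝ) ^ (3 / 2 : ℝ) * ε ∧
          (∀ (P : Letter) (j : Fin n),
            ‖onFst (Qubits (Fin n) ⊗[ℂ] EuclideanSpace ℂ (Fin mB))
                (pauliDefect UA (PA P j) (pauli P) j) (idealState n extra)‖
              ≤ C * (n : ℝ) ^ (3 / 2 : ℝ) * ε) ∧
          (∀ (P : Letter) (j : Fin n),
            ‖onSnd (Qubits (Fin n) ⊗[ℂ] EuclideanSpace ℂ (Fin mA))
                (pauliDefect UB (PB P j) (pauli P) j) (idealState n extra)‖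
              ≤ C * (n : ℝ) ^ (3 / 2 : ℝ) * ε) := by
  -- `65 = 9 + 2 · 28`: the extraction error `9nε`, with `n ≤ n^{3/2}`, plus twice the distance `28
  -- n^{3/2} ε` to the ideal state.
  refine ⟨65, by norm_num, ?_⟩
  intro n ε HA _ _ _ HB _ _ _ ψ PA PB h
  have hA := h.isQubitFamily_A
  have hB := h.isQubitFamily_B
  have hxA := isExtension_ancilla hA
  have hxB := isExtension_ancilla hB
  -- For `n = 0` the hypotheses allow negative `ε`, but then the factor `n^{3/2}` is zero.
  have hε : 0 < n → 0 ≤ ε := fun hn => h.nonneg ⟨0, hn⟩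
  have hrefA (P : Letter) (j : Fin n) := isReflection_extracted hxA.left hxA.mid hxA.left_mid P j
  have hrefB (P : Letter) (j : Fin n) := isReflection_extracted hxB.left hxB.mid hxB.left_mid P j
  have hstab (P : Letter) (j : Fin n) :
      ‖TensorProduct.map (extracted (withAncilla PA) (ancilla HA n 0) P j)
        (extracted (withAncilla PB) (ancilla HB n 0) P j) (extendedState n ψ) -
        extendedState n ψ‖ ≤ 19 * n * ε := by
    -- The sum `9nε + 9nε + ε` is at most `19nε` because the index `j` forces `n ≥ 1`.
    have hε' := h.nonneg j
    have hn : (1 : ℝ) ≤ n := by exact_mod_cast j.pos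
    refine (norm_map_sub_le (hrefA P j) (hxB.left.reflection P j)
      (h.norm_onFst_extracted_sub_le hε' P j) (h.norm_onSnd_extracted_sub_le hε' P j)
      (h.norm_withAncilla_sub_le P j)).trans ?_
    nlinarith
  obtain ⟨extra, hextra, hclose⟩ := exists_idealState_close (δ := 19 * n * ε)
    (φ := TensorProduct.congrIsometry (extractionUnitary hA) (extractionUnitary hB)
      (extendedState n ψ))
    ((LinearIsometryEquiv.norm_map _ _).trans ((norm_extendedState ψ).trans h.norm_state))
    (fun P j => (norm_map_congrIsometry_sub (onQubit_extractionUnitary hA P j)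
      (onQubit_extractionUnitary hB P j) (extendedState n ψ)).trans_le (hstab P j))
  replace hclose := hclose.trans (two_mul_sqrt_le hε)
  have hle := natCast_le_rpow (n := n)
  refine ⟨residualDim HA n, residualDim HB n, extractionUnitary hA, extractionUnitary hB, extra,
    hextra, hclose.trans ?_, fun P j => ?_, fun P j => ?_⟩
  · rcases Nat.eq_zero_or_pos n with rfl | hn
    · norm_num
    · have := hε hn
      gcongr
      norm_num
  · have hε' := h.nonneg j
    have h₁ := norm_onFst_defect_le (V := extractionUnitary hB) (hxA.left.reflection P j)
      (hrefA P j) (pauliDefect_extractionUnitary hA P j) (extendedState n ψ) (idealState n extra)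
    have h₂ := h.norm_onFst_extracted_sub_le hε' P j
    refine h₁.trans ?_
    nlinarith
  · have hε' := h.nonneg j
    have h₁ := norm_onSnd_defect_le (U := extractionUnitary hA) (hxB.left.reflection P j)
      (hrefB P j) (pauliDefect_extractionUnitary hB P j) (extendedState n ψ) (idealState n extra)
    have h₂ := h.norm_onSnd_extracted_sub_le hε' P j
    refine h₁.trans ?_
    nlinarith
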